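/- Throughout, $\mathcal L_2^n$ is the space of (classes of) square-integrable functions $[0,\infty)\to\mathbb R^n$, with $\langle u,y\rangle=\int_0^\infty u(t)^\top y(t)\,dt$ and $\|u\|=\sqrt{\langle u,u\rangle}$, and $\mathbb S^k$ is the set of real symmetric $k\times k$ matrices. For $u,y\in\mathcal L_2^n$ with $u\neq 0$, the gain is $\rho(u,y)=\|y\|/\|u\|$, and the phase is $\theta(u,y)=\arccos\frac{\langle u,y\rangle}{\|u\|\,\|y\|}$ if $y\ne0$ and $\theta(u,0)=0$. The scaled graph of a (possibly set-valued) system $H$ on $\mathcal L_2^n$ is $$\mathrm{SG}(H)=\{\rho(u,y)e^{\pm j\theta(u,y)} \mid u\in\mathcal L_2^n\setminus\{0\},\ y\in H(u)\}\subset\mathbb C .$$ **Theorem.** Let $A\in\mathbb R^{m\times m}$, $B\in\mathbb R^{m\times n}$, $C\in\mathbb R^{n\times m}$, $D\in\mathbb R^{n\times n}$, and let $H_L$ be the LTI system on $\mathcal L_2^n$ given by $$\dot x(t)=Ax(t)+Bu(t),\quad x(0)=0,\qquad y(t)=Cx(t)+Du(t).$$ Assume that $A$ is Hurwitz, that is,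 all its eigenvalues have strictly negative real part. Let $\Pi\in\mathbb S^2$ and $$\Theta(\Pi)=\begin{bmatrix}C&D\\0&I\end{bmatrix}^\top(\Pi\otimes I_n)\begin{bmatrix}C&D\\0&I\end{bmatrix},\qquad \mathcal S(\Pi)=\left\{z\in\mathbb C\ \middle|\ \begin{bmatrix}z\\1\end{bmatrix}^*\Pi\begin{bmatrix}z\\1\end{bmatrix}\ge0\right\}.$$ Consider the following statements: 1. There exists $P\in\mathbb S^m$ with $$\begin{bmatrix}A&B\\I&0\end{bmatrix}^\top\begin{bmatrix}0&P\\P&0\end{bmatrix}\begin{bmatrix}A&B\\I&0\end{bmatrix}-\Theta(\Pi)\preceq0 .$$ 2. For all $u\in\mathcal L_2^n$ and $y\in H_L(u)$, $$\int_0^\infty\begin{bmatrix}y(t)\\u(t)\end{bmatrix}^\top(\Pi\otimes I_n)\begin{bmatrix}y(t)\\u(t)\end{bmatrix}dt\ge0 .$$ 3. $\mathrm{SG}(H_L)\subseteq\mathcal S(\Pi)$. Then (1) implies (2), (1) implies (3), and (2) is equivalent to (3). If, in addition, $(A,B)$ is controllable (every state can be steered to every other state in finite time), then (1), (2) and (3)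 are equivalent. -/

import Mathlib

open MeasureTheory Set
open scoped Matrix Kronecker

noncomputable section

namespace ScaledGraph

/-! ### Signals and scaled graphs -/

/-- The space of square-integrable signals on the half-line `[0, ∞)` with values in Euclidean
`n`-space. Its norm and inner product are those of Mathlib. -/
abbrev L2Signal (n : ℕ) : Type :=
  Lp (EuclideanSpace ℝ (Fin n)) 2 (volume.restrict (Ici (0 : ℝ)))

/-- A (possibly set-valued) system; `y ∈ H u` says that `y` is an output for the input `u`. -/
abbrev System (n : ℕ) : Type := L2Signal n → Set (L2Signal n)

/-- The gain `‖y‖ / ‖u‖`, used for `u ≠ 0` only. -/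
def gain {n : ℕ} (u y : L2Signal n) : ℝ := ‖y‖ / ‖u‖

open Classical in
/-- The phase, used for `u ≠ 0` only: the angle between `u` and `y`, and `0` if `y = 0`. -/
def phase {n : ℕ} (u y : L2Signal n) : ℝ :=
  if y = 0 then 0 else Real.arccos (inner ℝ u y / (‖u‖ * ‖y‖))

/-- The scaled graph of `H` over the inputs in `U`. -/
def SGOver {n : ℕ} (U : Set (L2Signal n)) (H : System n) : Set ℂ :=
  {z | ∃ u ∈ U \ {0}, ∃ y ∈ H u,
    z = (gain u y : ℂ) * Complex.exp (Complex.I * (phase u y : ℂ)) ∨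
    z = (gain u y : ℂ) * Complex.exp (-(Complex.I * (phase u y : ℂ)))}

/-- The scaled graph of `H` over all square-integrable inputs. -/
def SG {n : ℕ} (H : System n) : Set ℂ := SGOver Set.univ H

/-- The region of all `z` with `[z; 1]^* Π [z; 1] ≥ 0`. For symmetric `Π` this quadratic form
is real, so taking its real part loses nothing. -/
def region (Pi : Matrix (Fin 2) (Fin 2) ℝ) : Set ℂ :=
  {z | 0 ≤ (star ![z, 1] ⬝ᵥ (Pi.map ((↑) : ℝ → ℂ) *ᵥ ![z, 1])).re}

/-! ### The multiplier and the integral quadratic constraint -/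

/-- The identification of the index set of `Π ⊗ I_n` with that of a stacked vector `[y; u]`. -/
def stackEquiv (n : ℕ) : Fin 2 × Fin n ≃ Fin n ⊕ Fin n :=
  (finTwoEquiv.prodCongr (Equiv.refl (Fin n))).trans (Equiv.boolProdEquivSum (Fin n))

/-- `Π ⊗ I_n` as a matrix acting on stacked vectors `[y; u]`. -/
def kronId (n : ℕ) (Pi : Matrix (Fin 2) (Fin 2) ℝ) :
    Matrix (Fin n ⊕ Fin n) (Fin n ⊕ Fin n) ℝ :=
  Matrix.reindex (stackEquiv n) (stackEquiv n) (Pi ⊗ₖ (1 : Matrix (Fin n) (Fin n) ℝ))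

theorem kronId_eq_fromBlocks (n : ℕ) (Pi : Matrix (Fin 2) (Fin 2) ℝ) :
    kronId n Pi = Matrix.fromBlocks (Pi 0 0 • 1) (Pi 0 1 • 1) (Pi 1 0 • 1) (Pi 1 1 • 1) := by
  ext i j
  rcases i with i | i <;> rcases j with j | j <;>
    simp [kronId, stackEquiv, Matrix.kroneckerMap_apply, finTwoEquiv, Equiv.boolProdEquivSum]

/-- The supply rate `[y; u]ᵀ (Π ⊗ I_n) [y; u]`. -/
def supplyRate {n : ℕ} (Pi : Matrix (Fin 2) (Fin 2) ℝ) (u y : EuclideanSpace ℝ (Fin n)) : ℝ :=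
  Sum.elim y.ofLp u.ofLp ⬝ᵥ (kronId n Pi *ᵥ Sum.elim y.ofLp u.ofLp)

/-- The integral quadratic constraint with multiplier `Π` for the pair `(u, y)`. -/
def IQC {n : ℕ} (Pi : Matrix (Fin 2) (Fin 2) ℝ) (u y : L2Signal n) : Prop :=
  0 ≤ ∫ t in Ici (0 : ℝ), supplyRate Pi (u t) (y t)

/-! ### Linear time-invariant systems -/

/-- The matrices of a square state-space system with `m` states, `n` inputs and `n` outputs. -/
structure LTI (m n : ℕ) where
  A : Matrix (Fin m) (Fin m) ℝ
  B : Matrix (Fin m) (Fin n) ℝ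
  C : Matrix (Fin n) (Fin m) ℝ
  D : Matrix (Fin n) (Fin n) ℝ

/-- `x` is the solution on `[0, ∞)` of `x' = A x + B u`, `x 0 = x₀`, in the sense of
Carathéodory, that is, of the equivalent integral equation. -/
def IsStateTrajectory {m n : ℕ} (A : Matrix (Fin m) (Fin m) ℝ) (B : Matrix (Fin m) (Fin n) ℝ)
    (x₀ : Fin m → ℝ) (u : L2Signal n) (x : ℝ → Fin m → ℝ) : Prop :=
  ContinuousOn x (Ici 0) ∧
    ∀ t, 0 ≤ t → x t = x₀ + ∫ s in (0 : ℝ)..t, (A *ᵥ x s + B *ᵥ (u s).ofLp)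

/-- The input-output system defined by `x' = A x + B u`, `x 0 = 0`, `y = C x + D u`. -/
def LTI.toSystem {m n : ℕ} (L : LTI m n) : System n := fun u =>
  {y | ∃ x : ℝ → Fin m → ℝ, IsStateTrajectory L.A L.B 0 u x ∧
    ∀ᵐ t ∂(volume.restrict (Ici (0 : ℝ))),
      (y t).ofLp = L.C *ᵥ x t + L.D *ᵥ (u t).ofLp}

/-- All complex eigenvalues have strictly negative real part. -/
def IsHurwitz {m : ℕ} (A : Matrix (Fin m) (Fin m) ℝ) : Prop :=
  ∀ μ ∈ spectrum ℂ (A.map ((↑) : ℝ → ℂ)), μ.re < 0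

/-- Controllability of `(A, B)`: every state can be steered to every state in finite time. -/
def IsControllable {m n : ℕ} (A : Matrix (Fin m) (Fin m) ℝ)
    (B : Matrix (Fin m) (Fin n) ℝ) : Prop :=
  ∀ x₀ x₁ : Fin m → ℝ, ∃ T : ℝ, 0 < T ∧ ∃ (u : L2Signal n) (x : ℝ → Fin m → ℝ),
    IsStateTrajectory A B x₀ u x ∧ x T = x₁

/-! ### The linear matrix inequality -/

/-- `M ⪯ 0`. -/
def NegSemidef {ι : Type} [Fintype ι] (M : Matrix ι ι ℝ) : Prop := (-M).PosSemidef

/-- The block matrix `[C D; 0 I]`. -/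
def LTI.outputBlock {m n : ℕ} (L : LTI m n) : Matrix (Fin n ⊕ Fin n) (Fin m ⊕ Fin n) ℝ :=
  Matrix.fromBlocks L.C L.D 0 1

/-- The block matrix `[A B; I 0]`. -/
def LTI.stateBlock {m n : ℕ} (L : LTI m n) : Matrix (Fin m ⊕ Fin m) (Fin m ⊕ Fin n) ℝ :=
  Matrix.fromBlocks L.A L.B 1 0

/-- `Θ(Π) = [C D; 0 I]ᵀ (Π ⊗ I_n) [C D; 0 I]`. -/
def LTI.Theta {m n : ℕ} (L : LTI m n) (Pi : Matrix (Fin 2) (Fin 2) ℝ) :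
    Matrix (Fin m ⊕ Fin n) (Fin m ⊕ Fin n) ℝ :=
  L.outputBlockᵀ * kronId n Pi * L.outputBlock

/-- `[A B; I 0]ᵀ [0 P; P 0] [A B; I 0] - Θ(Π)`. -/
def LTI.kypMatrix {m n : ℕ} (L : LTI m n) (Pi : Matrix (Fin 2) (Fin 2) ℝ)
    (P : Matrix (Fin m) (Fin m) ℝ) : Matrix (Fin m ⊕ Fin n) (Fin m ⊕ Fin n) ℝ :=
  L.stateBlockᵀ * Matrix.fromBlocks 0 P P 0 * L.stateBlock - L.Theta Pi

end ScaledGraph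

end

open MeasureTheory Set
open scoped Matrix Kronecker

noncomputable section

namespace ScaledGraph

/-! ### Functions given by an integral equation -/

/-! The equivalence of (2) and (3) is pointwise. If `u ≠ 0` and `z` is a point of the scaled graph
given by `(u, y)`, then `‖u‖²` times the quadratic form of `Π` at `[z; 1]` is the integrated supply
rate of `(u, y)` (`mem_region_iff_iqc`). The input `u = 0`, which scaled graphs leave out, has only
the output `0` by uniqueness for the state equation.

For (1) ⇒ (2), the matrix inequality says that `xᵀPx` grows no faster than the supply
(`LTI.negSemidef_kypMatrix_iff`). Integration from the state `0` gives `x(T)ᵀPx(T) ≤ ∫₀ᵀ supply`.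
Since `P` may be indefinite, the left side has to be controlled at infinity: stability makes `x`
square-integrable (`IsStateTrajectory.memLp_two`), so `xᵀPx` is integrable and cannot stay below a
negative constant, as a negative total supply would force.

For (2) ⇒ (1), let `S(v)` be the infimum of the total supply over all square-integrable behaviours
starting at `v`. Stability makes this set nonempty. Controllability and (2) bound it below: a
behaviour from `v`, prefixed by a path from `0` to `v`, has nonnegative supply. A fibrewise infimum
of a quadratic form is again quadratic (`exists_quadraticForm_isGLB`), and concatenation gives the
dynamic programming inequality `S(x(0)) ≤ ∫₀ᵀ supply + S(x(T))` (`LTI.exists_quadratic_storage`).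
Localised at time `0` along constant inputs, it becomes the matrix inequality for the matrix `P` of
`-S`. -/

/-- Lebesgue measure on the half-line `[0, ∞)`. -/
abbrev halfLine : Measure ℝ := volume.restrict (Ici (0 : ℝ))

/-- Integration by parts for absolutely continuous functions. The inputs are only square-integrable,
so states are differentiable only almost everywhere; the energy estimate and the storage balance
both rest on this form of the product rule. -/
theorem intervalIntegral_mul_add_mul {f g a b : ℝ → ℝ} {a₀ b₀ T : ℝ} (hT : 0 ≤ T)
    (hf : IntervalIntegrable f volume 0 T) (hg : IntervalIntegrable g volume 0 T)
    (ha : ∀ t ∈ Icc 0 T, a t = a₀ + ∫ s in (0 : ℝ)..t, f s)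
    (hb : ∀ t ∈ Icc 0 T, b t = b₀ + ∫ s in (0 : ℝ)..t, g s) :
    ∫ t in (0 : ℝ)..T, (f t * b t + a t * g t) = a T * b T - a₀ * b₀ := by
  set F : ℝ → ℝ := fun t => (∫ s in (0 : ℝ)..t, f s) with hF
  set G : ℝ → ℝ := fun t => (∫ s in (0 : ℝ)..t, g s) with hG
  have hFac : AbsolutelyContinuousOnInterval F 0 T :=
    hf.absolutelyContinuousOnInterval_intervalIntegral (c := 0) (by simp)
  have hGac : AbsolutelyContinuousOnInterval G 0 T :=
    hg.absolutelyContinuousOnInterval_intervalIntegral (c := 0) (by simp)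
  have hcac (c : ℝ) : AbsolutelyContinuousOnInterval (fun _ : ℝ => c) 0 T := by
    have h : LipschitzOnWith 0 (fun _ : ℝ => c) (uIcc 0 T) :=
      (LipschitzWith.const c).lipschitzOnWith
    exact h.absolutelyContinuousOnInterval
  have h := ((hcac a₀).add hFac).integral_deriv_mul_eq_sub ((hcac b₀).add hGac)
  have hF0 : F 0 = 0 := by simp [F]
  have hG0 : G 0 = 0 := by simp [G]
  rw [ha T ⟨hT, le_rfl⟩, hb T ⟨hT, le_rfl⟩]
  simp only [Pi.add_apply, hF0, hG0, add_zero] at h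
  rw [← h]
  apply intervalIntegral.integral_congr_ae
  filter_upwards [hf.ae_hasDerivAt_integral, hg.ae_hasDerivAt_integral] with t h1 h2 ht
  have htT : t ∈ uIcc 0 T := uIoc_subset_uIcc ht
  have e1 := ((h1 htT 0 (by simp)).const_add a₀).deriv
  have e2 := ((h2 htT 0 (by simp)).const_add b₀).deriv
  have e1' : deriv ((fun _ => a₀) + F) t = f t := e1
  have e2' : deriv ((fun _ => b₀) + G) t = g t := e2
  rw [e1', e2']
  rw [uIcc_of_le hT] at htT
  rw [ha t htT, hb t htT]

theorem intervalIntegrable_of_memLp_two {E : Type*} [NormedAddCommGroup E] {f : ℝ → E}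
    (hf : MemLp f 2 halfLine) {a b : ℝ} (ha : 0 ≤ a) (hb : 0 ≤ b) :
    IntervalIntegrable f volume a b := by
  have hsub : uIoc a b ⊆ Ici 0 := fun t ht => (le_min ha hb).trans ht.1.le
  have h : MemLp f 2 (volume.restrict (uIoc a b)) :=
    hf.mono_measure (Measure.restrict_mono hsub le_rfl)
  have : IsFiniteMeasure (volume.restrict (uIoc a b)) := ⟨by simp [uIoc]⟩
  rw [intervalIntegrable_iff]
  exact h.integrable (by norm_num)

theorem intervalIntegrable_of_continuousOn_Ici {E : Type*} [NormedAddCommGroup E] {f : ℝ → E}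
    (hf : ContinuousOn f (Ici 0)) {a b : ℝ} (ha : 0 ≤ a) (hb : 0 ≤ b) :
    IntervalIntegrable f volume a b :=
  (hf.mono fun _ ht => (le_min ha hb).trans ht.1).intervalIntegrable

/-! ### Square-integrability of stable trajectories -/

/-- A stable scalar linear equation with square-integrable forcing has square-integrable
solutions. -/
theorem memLp_two_of_stable_scalar {μ : ℂ} (hμ : μ.re < 0) {w g : ℝ → ℂ} {w₀ : ℂ}
    (hg : MemLp g 2 halfLine) (hw : ContinuousOn w (Ici 0))
    (h : ∀ t, 0 ≤ t → w t = w₀ + ∫ s in (0 : ℝ)..t, (μ * w s + g s)) :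
    MemLp w 2 halfLine := by
  have hgi {t : ℝ} (ht : 0 ≤ t) : IntervalIntegrable g volume 0 t :=
    intervalIntegrable_of_memLp_two hg le_rfl ht
  have hwi {t : ℝ} (ht : 0 ≤ t) : IntervalIntegrable w volume 0 t :=
    intervalIntegrable_of_continuousOn_Ici hw le_rfl ht
  have hfi {t : ℝ} (ht : 0 ≤ t) : IntervalIntegrable (fun s => μ * w s + g s) volume 0 t :=
    ((hwi ht).const_mul μ).add (hgi ht)
  have hre {t : ℝ} (ht : 0 ≤ t) :
      (w t).re = w₀.re + ∫ s in (0 : ℝ)..t, (μ * w s + g s).re := by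
    rw [h t ht, Complex.add_re]
    congr 1
    exact (Complex.reCLM.intervalIntegral_comp_comm (hfi ht)).symm
  have him {t : ℝ} (ht : 0 ≤ t) :
      (w t).im = w₀.im + ∫ s in (0 : ℝ)..t, (μ * w s + g s).im := by
    rw [h t ht, Complex.add_im]
    congr 1
    exact (Complex.imCLM.intervalIntegral_comp_comm (hfi ht)).symm
  have hrei {t : ℝ} (ht : 0 ≤ t) :
      IntervalIntegrable (fun s => (μ * w s + g s).re) volume 0 t :=
    ⟨(hfi ht).1.re, (hfi ht).2.re⟩
  have himi {t : ℝ} (ht : 0 ≤ t) :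
      IntervalIntegrable (fun s => (μ * w s + g s).im) volume 0 t :=
    ⟨(hfi ht).1.im, (hfi ht).2.im⟩
  have hgsq : Integrable (fun s => ‖g s‖ ^ 2) halfLine := hg.integrable_norm_pow (by norm_num)
  have hwsq : ContinuousOn (fun s => ‖w s‖ ^ 2) (Ici 0) := (hw.norm).pow 2
  have hwsqi {t : ℝ} (ht : 0 ≤ t) : IntervalIntegrable (fun s => ‖w s‖ ^ 2) volume 0 t :=
    intervalIntegrable_of_continuousOn_Ici hwsq le_rfl ht
  have hgsqi {t : ℝ} (ht : 0 ≤ t) : IntervalIntegrable (fun s => ‖g s‖ ^ 2) volume 0 t := by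
    rw [intervalIntegrable_iff, uIoc_of_le ht]
    exact IntegrableOn.mono_set (t := Ici 0) hgsq fun s hs => hs.1.le
  -- Energy estimate: the derivative of `|w|²` is `-2δ|w|² + 2 Re(w̄ g)`, and Young's inequality
  -- with weight `δ` bounds it by `-δ|w|² + δ⁻¹|g|²`. Integration bounds `∫₀ᵀ |w|²` uniformly in
  -- `T`.
  set δ : ℝ := -μ.re with hδ
  have hδ0 : 0 < δ := by simp [hδ, hμ]
  have key {T : ℝ} (hT : 0 ≤ T) : ∫ s in (0 : ℝ)..T, ‖w s‖ ^ 2 ≤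
      δ⁻¹ * (‖w₀‖ ^ 2 + δ⁻¹ * ∫ s, ‖g s‖ ^ 2 ∂halfLine) := by
    have e1 := intervalIntegral_mul_add_mul hT (hrei hT) (hrei hT)
      (fun t ht => hre ht.1) (fun t ht => hre ht.1)
    have e2 := intervalIntegral_mul_add_mul hT (himi hT) (himi hT)
      (fun t ht => him ht.1) (fun t ht => him ht.1)
    have hcr : ContinuousOn (fun t => (w t).re) (uIcc 0 T) :=
      (Complex.continuous_re.comp_continuousOn hw).mono
        (by rw [uIcc_of_le hT]; exact Icc_subset_Ici_self)
    have hci : ContinuousOn (fun t => (w t).im) (uIcc 0 T) :=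
      (Complex.continuous_im.comp_continuousOn hw).mono
        (by rw [uIcc_of_le hT]; exact Icc_subset_Ici_self)
    have i1 := ((hrei hT).mul_continuousOn hcr).add ((hrei hT).continuousOn_mul hcr)
    have i2 := ((himi hT).mul_continuousOn hci).add ((himi hT).continuousOn_mul hci)
    have i3 : IntervalIntegrable (fun s => -δ * ‖w s‖ ^ 2 + δ⁻¹ * ‖g s‖ ^ 2) volume 0 T :=
      ((hwsqi hT).const_mul _).add ((hgsqi hT).const_mul _)
    have hle := intervalIntegral.integral_mono_on hT (i1.add i2) i3 (fun s _ => by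
      have hd : δ * δ⁻¹ = 1 := mul_inv_cancel₀ hδ0.ne'
      have a1 := mul_nonneg hδ0.le (sq_nonneg ((w s).re - δ⁻¹ * (g s).re))
      have a2 := mul_nonneg hδ0.le (sq_nonneg ((w s).im - δ⁻¹ * (g s).im))
      have b1 : δ * ((w s).re - δ⁻¹ * (g s).re) ^ 2 =
        δ * (w s).re ^ 2 - 2 * (w s).re * (g s).re + δ⁻¹ * (g s).re ^ 2 := by field_simp; ring
      have b2 : δ * ((w s).im - δ⁻¹ * (g s).im) ^ 2 =
        δ * (w s).im ^ 2 - 2 * (w s).im * (g s).im + δ⁻¹ * (g s).im ^ 2 := by field_simp; ring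
      have hm : μ.re = -δ := by simp [hδ]
      simp only [Complex.add_re, Complex.mul_re, Complex.add_im, Complex.mul_im,
        Complex.sq_norm, Complex.normSq_apply, hm]
      nlinarith)
    rw [intervalIntegral.integral_add i1 i2, e1, e2,
      intervalIntegral.integral_add ((hwsqi hT).const_mul _) ((hgsqi hT).const_mul _),
      intervalIntegral.integral_const_mul, intervalIntegral.integral_const_mul] at hle
    have hG : ∫ s in (0 : ℝ)..T, ‖g s‖ ^ 2 ≤ ∫ s, ‖g s‖ ^ 2 ∂halfLine := by
      rw [intervalIntegral.integral_of_le hT]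
      exact setIntegral_mono_set hgsq (ae_of_all _ fun s => by positivity)
        (LE.le.eventuallyLE (fun s (hs : s ∈ Ioc 0 T) => hs.1.le))
    have hG' := mul_le_mul_of_nonneg_left hG (inv_pos.2 hδ0).le
    have hn : ‖w₀‖ ^ 2 = w₀.re * w₀.re + w₀.im * w₀.im := by
      rw [Complex.sq_norm, Complex.normSq_apply]
    rw [inv_mul_eq_div, le_div_iff₀ hδ0]
    nlinarith [mul_self_nonneg (w T).re, mul_self_nonneg (w T).im]
  rw [memLp_two_iff_integrable_sq_norm (hw.aestronglyMeasurable measurableSet_Ici)]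
  change IntegrableOn _ (Ici 0) volume
  rw [integrableOn_Ici_iff_integrableOn_Ioi]
  refine integrableOn_Ioi_of_intervalIntegral_norm_bounded (l := Filter.atTop) (b := id)
    (δ⁻¹ * (‖w₀‖ ^ 2 + δ⁻¹ * ∫ s, ‖g s‖ ^ 2 ∂halfLine)) 0 (fun T => ?_) Filter.tendsto_id ?_
  · exact ((hwsq.mono Icc_subset_Ici_self).integrableOn_compact
      (isCompact_Icc (a := 0) (b := T))).mono_set Ioc_subset_Icc_self
  · filter_upwards [Filter.eventually_ge_atTop 0] with T hT
    simpa using key hT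

theorem mulVec_eq_add_intervalIntegral {m k : ℕ} (N : Matrix (Fin k) (Fin m) ℂ)
    {x h : ℝ → Fin m → ℂ} {x₀ : Fin m → ℂ} {t : ℝ}
    (hh : ∀ i, IntervalIntegrable (fun s => h s i) volume 0 t)
    (hx : ∀ i, x t i = x₀ i + ∫ s in (0 : ℝ)..t, h s i) (i : Fin k) :
    (N *ᵥ x t) i = (N *ᵥ x₀) i + ∫ s in (0 : ℝ)..t, (N *ᵥ h s) i := by
  simp only [Matrix.mulVec, dotProduct, hx, mul_add, Finset.sum_add_distrib]
  rw [intervalIntegral.integral_finsetSum fun j _ => (hh j).const_mul _]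
  simp only [intervalIntegral.integral_const_mul]

theorem memLp_mulVec_apply {m k : ℕ} {p : ENNReal} {μ : Measure ℝ} (N : Matrix (Fin k) (Fin m) ℂ)
    {f : ℝ → Fin m → ℂ} (hf : ∀ i, MemLp (fun t => f t i) p μ) (i : Fin k) :
    MemLp (fun t => (N *ᵥ f t) i) p μ := by
  simp only [Matrix.mulVec, dotProduct]
  exact memLp_finsetSum _ fun j _ => (hf j).const_mul _

theorem continuousOn_mulVec_apply {m k : ℕ} {s : Set ℝ} (N : Matrix (Fin k) (Fin m) ℂ)
    {f : ℝ → Fin m → ℂ} (hf : ∀ i, ContinuousOn (fun t => f t i) s) (i : Fin k) :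
    ContinuousOn (fun t => (N *ᵥ f t) i) s := by
  simp only [Matrix.mulVec, dotProduct]
  exact continuousOn_finsetSum _ fun j _ => (hf j).const_smul (N i j)

/-- If `∏ (A - μ)` maps a forced trajectory of `A` to a square-integrable function and all the
`μ` are stable, then the trajectory is square-integrable. -/
theorem memLp_two_of_prod_sub_mulVec {m : ℕ} (A : Matrix (Fin m) (Fin m) ℂ) (l : List ℂ) :
    ∀ {x f : ℝ → Fin m → ℂ} {x₀ : Fin m → ℂ}, (∀ μ ∈ l, μ.re < 0) →
      (∀ i, MemLp (fun t => f t i) 2 halfLine) → (∀ i, ContinuousOn (fun t => x t i) (Ici 0)) →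
      (∀ i t, 0 ≤ t → x t i = x₀ i + ∫ s in (0 : ℝ)..t, (A *ᵥ x s + f s) i) →
      (∀ i, MemLp (fun t => ((l.map fun μ => A - Matrix.scalar _ μ).prod *ᵥ x t) i) 2 halfLine) →
      ∀ i, MemLp (fun t => x t i) 2 halfLine := by
  induction l with
  | nil => intro x f x₀ _ _ _ _ h; simpa using h
  | cons μ l ih =>
    intro x f x₀ hl hf hx hxe hp
    set N := A - Matrix.scalar _ μ with hN
    have hAN : A * N = N * A := by
      rw [hN, mul_sub, sub_mul, (Matrix.scalar_commute μ (fun r => mul_comm μ r) A).eq]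
    have hcomm : N * (l.map fun μ => A - Matrix.scalar _ μ).prod =
        (l.map fun μ => A - Matrix.scalar _ μ).prod * N := by
      refine (Commute.list_prod_right _ _ fun M hM => ?_).eq
      obtain ⟨ν, -, rfl⟩ := List.mem_map.1 hM
      change N * _ = _ * N
      rw [mul_sub, sub_mul _ _ N, ← hAN, (Matrix.scalar_commute ν (fun r => mul_comm ν r) N).eq]
    have hint (i : Fin m) {t : ℝ} (ht : 0 ≤ t) :
        IntervalIntegrable (fun s => (A *ᵥ x s + f s) i) volume 0 t :=
      (intervalIntegrable_of_continuousOn_Ici (continuousOn_mulVec_apply A hx i) le_rfl ht).add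
        (intervalIntegrable_of_memLp_two (hf i) le_rfl ht)
    -- As `N` commutes with `A`, `N x` is a trajectory of `A` with forcing `N f`, and the remaining
    -- factors send it to a square-integrable function.
    have hw : ∀ i, MemLp (fun t => (N *ᵥ x t) i) 2 halfLine := by
      refine ih (f := fun t => N *ᵥ f t) (x₀ := N *ᵥ x₀)
        (fun ν hν => hl ν (List.mem_cons_of_mem _ hν)) (memLp_mulVec_apply N hf)
        (continuousOn_mulVec_apply N hx) (fun i t ht => ?_) (fun i => ?_)
      · rw [mulVec_eq_add_intervalIntegral N (fun i => hint i ht) (fun i => hxe i t ht)]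
        simp only [Matrix.mulVec_add, Matrix.mulVec_mulVec, hAN]
      · have h := hp i
        rw [List.map_cons, List.prod_cons, hcomm] at h
        simpa only [Matrix.mulVec_mulVec] using h
    intro i
    -- Writing `A = μ + N` decouples the coordinates: each `x i` solves a scalar equation with rate
    -- `μ` and square-integrable forcing `(N x + f) i`.
    refine memLp_two_of_stable_scalar (hl μ List.mem_cons_self) ((hw i).add (hf i)) (hx i)
      (w₀ := x₀ i) fun t ht => ?_
    rw [hxe i t ht]
    congr 2
    ext s
    simp [hN, Matrix.sub_mulVec, Matrix.scalar_apply, ← add_assoc]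

/-- Cayley–Hamilton, with the characteristic polynomial split over `ℂ`. Working with the list of its
roots avoids both diagonalization and bounds on the matrix exponential. -/
theorem exists_list_prod_sub_eq_zero {m : ℕ} {A : Matrix (Fin m) (Fin m) ℝ} (hA : IsHurwitz A) :
    ∃ l : List ℂ, (∀ μ ∈ l, μ.re < 0) ∧
      (l.map fun μ => A.map ((↑) : ℝ → ℂ) - Matrix.scalar (Fin m) μ).prod = 0 := by
  set A' := A.map ((↑) : ℝ → ℂ)
  have hs : A'.charpoly.Splits := IsAlgClosed.splits _
  refine ⟨A'.charpoly.roots.toList, fun μ hμ => hA μ ?_, ?_⟩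
  · rw [Matrix.mem_spectrum_iff_isRoot_charpoly]
    exact Polynomial.isRoot_of_mem_roots (Multiset.mem_toList.1 hμ)
  · have h := A'.aeval_self_charpoly
    rw [hs.eq_prod_roots_of_monic A'.charpoly_monic, ← Multiset.coe_toList A'.charpoly.roots,
      Multiset.map_coe, Multiset.prod_coe, map_list_prod, List.map_map] at h
    rw [← h]
    congr 1
    refine List.map_congr_left fun μ _ => ?_
    simp [Matrix.algebraMap_eq_diagonal, Matrix.scalar_apply]

/-! ### State trajectories on a bounded interval and on the half-line -/

/-- Multiplication of Euclidean vectors by a matrix. -/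
def mulVecCLM {m n : ℕ} (B : Matrix (Fin m) (Fin n) ℝ) :
    EuclideanSpace ℝ (Fin n) →L[ℝ] (Fin m → ℝ) :=
  LinearMap.toContinuousLinearMap (B.mulVecLin ∘ₗ (WithLp.linearEquiv 2 ℝ (Fin n → ℝ)).toLinearMap)

theorem continuous_mulVec {m k : ℕ} (A : Matrix (Fin m) (Fin k) ℝ) :
    Continuous fun v : Fin k → ℝ => A *ᵥ v :=
  Continuous.matrix_mulVec continuous_const continuous_id

theorem intervalIntegrable_state_rhs {m n : ℕ} (A : Matrix (Fin m) (Fin m) ℝ)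
    (B : Matrix (Fin m) (Fin n) ℝ) {u : ℝ → EuclideanSpace ℝ (Fin n)} {x : ℝ → Fin m → ℝ} {t : ℝ}
    (hx : ContinuousOn x (uIcc 0 t)) (hu : IntervalIntegrable u volume 0 t) :
    IntervalIntegrable (fun s => A *ᵥ x s + B *ᵥ (u s).ofLp) volume 0 t := by
  refine ((continuous_mulVec A).comp_continuousOn hx).intervalIntegrable.add ?_
  exact ⟨(mulVecCLM B).integrable_comp hu.1, (mulVecCLM B).integrable_comp hu.2⟩

theorem pi_intervalIntegral_apply {m : ℕ} {f : ℝ → Fin m → ℝ} {a b : ℝ}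
    (hf : IntervalIntegrable f volume a b) (i : Fin m) :
    (∫ s in a..b, f s) i = ∫ s in a..b, f s i :=
  ((ContinuousLinearMap.proj (R := ℝ) (φ := fun _ : Fin m => ℝ) i).intervalIntegral_comp_comm
    hf).symm

theorem pi_intervalIntegrable_apply {m : ℕ} {f : ℝ → Fin m → ℝ} {a b : ℝ}
    (hf : IntervalIntegrable f volume a b) (i : Fin m) :
    IntervalIntegrable (fun s => f s i) volume a b :=
  ⟨(ContinuousLinearMap.proj (R := ℝ) (φ := fun _ : Fin m => ℝ) i).integrable_comp hf.1,
    (ContinuousLinearMap.proj (R := ℝ) (φ := fun _ : Fin m => ℝ) i).integrable_comp hf.2⟩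

section
variable {m n : ℕ} {A : Matrix (Fin m) (Fin m) ℝ} {B : Matrix (Fin m) (Fin n) ℝ}
  {x₀ : Fin m → ℝ} {u : L2Signal n} {x : ℝ → Fin m → ℝ}

theorem L2Signal.intervalIntegrable (u : L2Signal n) {t : ℝ} (ht : 0 ≤ t) :
    IntervalIntegrable u volume 0 t :=
  intervalIntegrable_of_memLp_two (Lp.memLp u) le_rfl ht

theorem IsStateTrajectory.intervalIntegrable (h : IsStateTrajectory A B x₀ u x) {t : ℝ}
    (ht : 0 ≤ t) : IntervalIntegrable (fun s => A *ᵥ x s + B *ᵥ (u s).ofLp) volume 0 t :=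
  intervalIntegrable_state_rhs A B
    (h.1.mono (by rw [uIcc_of_le ht]; exact Icc_subset_Ici_self)) (u.intervalIntegrable ht)

/-- The states of a stable system with square-integrable input are square-integrable. -/
theorem IsStateTrajectory.memLp_two (hA : IsHurwitz A) (h : IsStateTrajectory A B x₀ u x) :
    MemLp x 2 halfLine := by
  obtain ⟨l, hl, hl0⟩ := exists_list_prod_sub_eq_zero hA
  have hBu : ∀ i, MemLp (fun t => (((B *ᵥ (u t).ofLp) i : ℝ) : ℂ)) 2 halfLine := fun i =>
    (((ContinuousLinearMap.proj (R := ℝ) (φ := fun _ : Fin m => ℝ) i).comp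
      (mulVecCLM B)).comp_memLp' (Lp.memLp u)).ofReal
  have hc := memLp_two_of_prod_sub_mulVec (A.map ((↑) : ℝ → ℂ)) l
    (x := fun t i => (x t i : ℂ)) (f := fun t i => (((B *ᵥ (u t).ofLp) i : ℝ) : ℂ))
    (x₀ := fun i => (x₀ i : ℂ)) hl hBu
    (fun i => Complex.continuous_ofReal.comp_continuousOn
      ((continuous_apply i).comp_continuousOn h.1))
    (fun i t ht => by
      have e := congrFun (h.2 t ht) i
      rw [Pi.add_apply, pi_intervalIntegral_apply (h.intervalIntegrable ht)] at e
      rw [e, Complex.ofReal_add, ← intervalIntegral.integral_ofReal]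
      congr 2
      ext s
      simp [Matrix.mulVec, dotProduct])
    (fun i => by rw [hl0]; simp)
  refine MemLp.of_eval fun i => ?_
  simpa using (hc i).re

end

/-! ### Partial minimization of quadratic forms -/

/-- The Jordan–von Neumann argument: four instances of the parallelogram law, from which all terms
with differences cancel. -/
theorem polar_add_left_of_parallelogram {V : Type*} [AddCommGroup V] {S : V → ℝ}
    (hpar : ∀ x y, S (x + y) + S (x - y) = 2 * S x + 2 * S y) (x x' y : V) :
    QuadraticMap.polar S (x + x') y = QuadraticMap.polar S x y + QuadraticMap.polar S x' y := by
  have h1 := hpar (x + y) x'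
  have h2 := hpar (x' + y) x
  have h3 := hpar y (x - x')
  have h4 := hpar x x'
  have e1 : x + y + x' = x + x' + y := by abel
  have e2 : x' + y + x = x + x' + y := by abel
  have e3 : y + (x - x') = x + y - x' := by abel
  have e4 : y - (x - x') = x' + y - x := by abel
  rw [e1] at h1
  rw [e2] at h2
  rw [e3, e4] at h3
  simp only [QuadraticMap.polar]
  linarith

/-- An additive map is odd, so an upper bound on a symmetric interval is also a lower bound;
boundedness near `0` gives continuity, hence real linearity. A one-sided bound is what an infimum
provides. -/
theorem additive_map_mul_of_le {f : ℝ → ℝ} (hadd : ∀ s t, f (s + t) = f s + f t) {c : ℝ}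
    (hc : ∀ t, |t| ≤ 1 → f t ≤ c) (t : ℝ) : f t = t * f 1 := by
  let F : ℝ →+ ℝ := AddMonoidHom.mk' f hadd
  have hbd : Bornology.IsBounded (F '' Metric.closedBall 0 1) := by
    refine (Metric.isBounded_iff_subset_closedBall 0).2 ⟨c, ?_⟩
    rintro _ ⟨s, hs, rfl⟩
    rw [mem_closedBall_zero_iff, Real.norm_eq_abs] at hs ⊢
    refine abs_le.2 ⟨?_, hc s hs⟩
    have h := hc (-s) (by rwa [abs_neg])
    have h' : f (-s) = - f s := F.map_neg s
    have h2 : F s = f s := rfl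
    linarith
  have hF : Continuous F :=
    F.continuous_of_isBounded_nhds_zero (Metric.closedBall_mem_nhds 0 one_pos) hbd
  have h : F (t • 1) = t • F 1 := map_real_smul F hF t 1
  rw [smul_eq_mul, mul_one] at h
  exact h

/-- The fibrewise infimum of a quadratic form that is bounded below on the fibres of a linear
surjection is a quadratic form. -/
theorem exists_quadraticForm_isGLB {V W : Type*} [AddCommGroup V] [Module ℝ V] [AddCommGroup W]
    [Module ℝ W] (J : QuadraticForm ℝ W) (ev : W →ₗ[ℝ] V) (hev : Function.Surjective ev)
    (hb : ∀ v, BddBelow (J '' (ev ⁻¹' {v}))) :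
    ∃ S : QuadraticForm ℝ V, ∀ v, IsGLB (J '' (ev ⁻¹' {v})) (S v) := by
  set S : V → ℝ := fun v => sInf (J '' (ev ⁻¹' {v})) with hSdef
  have hS (v : V) : IsGLB (J '' (ev ⁻¹' {v})) (S v) := by
    obtain ⟨w, hw⟩ := hev v
    exact isGLB_csInf ⟨J w, w, hw, rfl⟩ (hb v)
  have hle (w : W) : S (ev w) ≤ J w := (hS _).1 ⟨w, rfl, rfl⟩
  have hge {v : V} {c : ℝ} (h : ∀ w, ev w = v → c ≤ J w) : c ≤ S v :=
    (hS v).2 (by rintro _ ⟨w, hw, rfl⟩; exact h w hw)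
  have hker (w : W) (hw : ev w = 0) : 0 ≤ J w := by
    obtain ⟨c, hc⟩ := hb 0
    by_contra! hneg
    -- With this `t ≥ 1`, `J (t • w) = t² J w ≤ t J w = J w - |c| < c`, which contradicts the lower
    -- bound on the fibre over `0`.
    set t : ℝ := 1 + |c| / (-J w) with ht
    have h := hc ⟨t • w, by simp [hw], rfl⟩
    rw [QuadraticMap.map_smul, smul_eq_mul] at h
    have h1 : 1 ≤ t := by
      have : 0 ≤ |c| / (-J w) := div_nonneg (abs_nonneg c) (by linarith)
      linarith
    have h2 : t * (-J w) = -J w + |c| := by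
      rw [ht, add_mul, one_mul, div_mul_cancel₀ _ (by linarith)]
    have h3 : t * (-J w) ≤ t * t * (-J w) :=
      mul_le_mul_of_nonneg_right (by nlinarith) (by linarith)
    have h4 := neg_abs_le c
    linarith
  have hS0 : S 0 = 0 := by
    refine le_antisymm ?_ (hge hker)
    simpa using hle 0
  have hsmul_le (a : ℝ) (ha : a ≠ 0) (v : V) : S (a • v) ≤ a * a * S v := by
    have ha2 : 0 < a * a := mul_self_pos.2 ha
    have h : (a * a)⁻¹ * S (a • v) ≤ S v := hge fun w hw => by
      have h := hle (a • w)
      rw [map_smul, hw, QuadraticMap.map_smul, smul_eq_mul] at h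
      rwa [inv_mul_le_iff₀ ha2]
    rwa [inv_mul_le_iff₀ ha2] at h
  have hsmul (a : ℝ) (v : V) : S (a • v) = a * a * S v := by
    rcases eq_or_ne a 0 with rfl | ha
    · simp [hS0]
    refine le_antisymm (hsmul_le a ha v) ?_
    have h := hsmul_le a⁻¹ (inv_ne_zero ha) (a • v)
    rw [smul_smul, inv_mul_cancel₀ ha, one_smul, ← mul_inv] at h
    rwa [le_inv_mul_iff₀ (mul_self_pos.2 ha)] at h
  -- Lifts `w`, `w'` of `x`, `y` give lifts `w ± w'` of `x ± y`, and `J` satisfies the parallelogram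
  -- law. The infimum is taken over `w'`, then over `w`.
  have hpar_le (x y : V) : S (x + y) + S (x - y) ≤ 2 * S x + 2 * S y := by
    have h1 (w : W) (hw : ev w = x) : (S (x + y) + S (x - y) - 2 * J w) / 2 ≤ S y :=
      hge fun w' hw' => by
        have h1 := hle (w + w')
        have h2 := hle (w - w')
        rw [map_add, hw, hw'] at h1
        rw [map_sub, hw, hw'] at h2
        have h3 := QuadraticMap.map_add J w w'
        have h4 := QuadraticMap.map_add J w (-w')
        rw [QuadraticMap.map_neg, QuadraticMap.polar_neg_right, ← sub_eq_add_neg] at h4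
        linarith
    have h2 : (S (x + y) + S (x - y) - 2 * S y) / 2 ≤ S x :=
      hge fun w hw => by linarith [h1 w hw]
    linarith
  have hpar (x y : V) : S (x + y) + S (x - y) = 2 * S x + 2 * S y := by
    -- The reverse inequality is the same one at `x + y`, `x - y`, by homogeneity.
    refine le_antisymm (hpar_le x y) ?_
    have h := hpar_le (x + y) (x - y)
    have e1 : x + y + (x - y) = (2 : ℝ) • x := by rw [two_smul]; abel
    have e2 : x + y - (x - y) = (2 : ℝ) • y := by rw [two_smul]; abel
    rw [e1, e2, hsmul, hsmul] at h
    linarith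
  have hadd := polar_add_left_of_parallelogram hpar
  have hpolar (a : ℝ) (x y : V) :
      QuadraticMap.polar S (a • x) y = a • QuadraticMap.polar S x y := by
    obtain ⟨w, rfl⟩ := hev x
    obtain ⟨w', rfl⟩ := hev y
    -- For fixed lifts `w`, `w'`, the bound `S (t x + y) ≤ J (t w + w')` controls the polar form
    -- from above, uniformly for `|t| ≤ 1`.
    have h := additive_map_mul_of_le (f := fun t => QuadraticMap.polar S (t • ev w) (ev w'))
      (c := |J w| + |QuadraticMap.polar J w w'| + |J w'| + |S (ev w)| + |S (ev w')|)
      (fun s t => by simp only [add_smul, hadd]) (fun t ht => by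
        have h1 := hle (t • w + w')
        rw [map_add, map_smul, QuadraticMap.map_add J, QuadraticMap.map_smul,
          QuadraticMap.polar_smul_left, smul_eq_mul, smul_eq_mul] at h1
        simp only [QuadraticMap.polar] at h1 ⊢
        rw [hsmul]
        have ht2 : |t * t| ≤ 1 := by rw [abs_mul]; nlinarith [abs_nonneg t]
        have b (r z : ℝ) (hr : |r| ≤ 1) : r * z ≤ |z| :=
          (le_abs_self _).trans (by rw [abs_mul]; nlinarith [abs_nonneg z])
        have b1 := b (t * t) (J w) ht2
        have b2 := b t (J (w + w') - J w - J w') ht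
        have b3 := b (-(t * t)) (S (ev w)) (by rwa [abs_neg])
        have b4 := neg_abs_le (S (ev w'))
        have b5 := le_abs_self (J w')
        linarith) a
    simpa using h
  exact ⟨QuadraticMap.ofPolar S (fun a x => by rw [hsmul, smul_eq_mul]) hadd hpolar, hS⟩

/-! ### The supply rate and its integral -/

theorem supplyRate_eq_inner {n : ℕ} (Pi : Matrix (Fin 2) (Fin 2) ℝ)
    (u y : EuclideanSpace ℝ (Fin n)) :
    supplyRate Pi u y =
      Pi 0 0 * inner ℝ y y + (Pi 0 1 + Pi 1 0) * inner ℝ u y + Pi 1 1 * inner ℝ u u := by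
  simp only [supplyRate, kronId_eq_fromBlocks, Matrix.fromBlocks_mulVec, Sum.elim_comp_inl,
    Sum.elim_comp_inr, sumElim_dotProduct_sumElim, Matrix.smul_mulVec, Matrix.one_mulVec,
    dotProduct_add, dotProduct_smul, EuclideanSpace.inner_eq_star_dotProduct, star_trivial,
    smul_eq_mul, dotProduct_comm u.ofLp y.ofLp]
  ring

/-- The integrated supply rate as a quadratic form in the pair `(u, y)`. -/
def totalSupply (n : ℕ) (Pi : Matrix (Fin 2) (Fin 2) ℝ) :
    QuadraticForm ℝ (L2Signal n × L2Signal n) :=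
  LinearMap.BilinMap.toQuadraticMap
    (Pi 0 0 • (innerₗ (L2Signal n)).compl₁₂ (LinearMap.snd ℝ _ _) (LinearMap.snd ℝ _ _) +
      (Pi 0 1 + Pi 1 0) •
        (innerₗ (L2Signal n)).compl₁₂ (LinearMap.fst ℝ _ _) (LinearMap.snd ℝ _ _) +
      Pi 1 1 • (innerₗ (L2Signal n)).compl₁₂ (LinearMap.fst ℝ _ _) (LinearMap.fst ℝ _ _))

theorem totalSupply_apply {n : ℕ} (Pi : Matrix (Fin 2) (Fin 2) ℝ) (u y : L2Signal n) :
    totalSupply n Pi (u, y) =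
      Pi 0 0 * inner ℝ y y + (Pi 0 1 + Pi 1 0) * inner ℝ u y + Pi 1 1 * inner ℝ u u := by
  simp [totalSupply]

theorem integrable_supplyRate {n : ℕ} (Pi : Matrix (Fin 2) (Fin 2) ℝ) (u y : L2Signal n) :
    Integrable (fun t => supplyRate Pi (u t) (y t)) halfLine := by
  simp only [supplyRate_eq_inner]
  exact (((L2.integrable_inner (𝕜 := ℝ) y y).const_mul _).add
    ((L2.integrable_inner u y).const_mul _)).add ((L2.integrable_inner u u).const_mul _)

theorem integral_supplyRate {n : ℕ} (Pi : Matrix (Fin 2) (Fin 2) ℝ) (u y : L2Signal n) :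
    ∫ t in Ici (0 : ℝ), supplyRate Pi (u t) (y t) = totalSupply n Pi (u, y) := by
  simp only [supplyRate_eq_inner, totalSupply_apply]
  have h1 := (L2.integrable_inner (𝕜 := ℝ) y y).const_mul (Pi 0 0)
  have h2 := (L2.integrable_inner (𝕜 := ℝ) u y).const_mul (Pi 0 1 + Pi 1 0)
  have h3 := (L2.integrable_inner (𝕜 := ℝ) u u).const_mul (Pi 1 1)
  refine (integral_add (h1.add h2) h3).trans ?_
  refine (congrArg (· + _) (integral_add h1 h2)).trans ?_
  rw [integral_const_mul, integral_const_mul, integral_const_mul]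
  rfl

theorem iqc_iff_totalSupply_nonneg {n : ℕ} (Pi : Matrix (Fin 2) (Fin 2) ℝ) (u y : L2Signal n) :
    IQC Pi u y ↔ 0 ≤ totalSupply n Pi (u, y) := by
  rw [IQC, integral_supplyRate]

/-! ### Scaled graphs and integral quadratic constraints -/

theorem mem_region_iff (Pi : Matrix (Fin 2) (Fin 2) ℝ) (z : ℂ) :
    z ∈ region Pi ↔ 0 ≤ Pi 0 0 * ‖z‖ ^ 2 + (Pi 0 1 + Pi 1 0) * z.re + Pi 1 1 := by
  have h : (star ![z, 1] ⬝ᵥ (Pi.map ((↑) : ℝ → ℂ) *ᵥ ![z, 1])).re =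
      Pi 0 0 * ‖z‖ ^ 2 + (Pi 0 1 + Pi 1 0) * z.re + Pi 1 1 := by
    simp [Matrix.mulVec, dotProduct, Fin.sum_univ_two, Complex.sq_norm, Complex.normSq_apply]
    ring
  rw [← h]
  rfl

theorem gain_mul_cos_phase {n : ℕ} {u : L2Signal n} (hu : u ≠ 0) (y : L2Signal n) :
    gain u y * Real.cos (phase u y) * ‖u‖ ^ 2 = inner ℝ u y := by
  have hu' : ‖u‖ ≠ 0 := norm_ne_zero_iff.2 hu
  by_cases hy : y = 0
  · simp [gain, hy]
  have hy' : ‖y‖ ≠ 0 := norm_ne_zero_iff.2 hy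
  have h := abs_le.1 (abs_real_inner_div_norm_mul_norm_le_one u y)
  rw [phase, if_neg hy, Real.cos_arccos h.1 h.2, gain]
  field_simp

/-- For symmetric or general real `Π`, membership in the region depends only on `‖z‖` and `z.re`, so
the sign of the phase is immaterial. Multiplying by `‖u‖² > 0` turns these into `‖y‖²` and `⟨u, y⟩`.
-/
theorem mem_region_iff_iqc {n : ℕ} (Pi : Matrix (Fin 2) (Fin 2) ℝ) {u : L2Signal n} (hu : u ≠ 0)
    (y : L2Signal n) {z : ℂ}
    (hz : z = (gain u y : ℂ) * Complex.exp (Complex.I * (phase u y : ℂ)) ∨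
      z = (gain u y : ℂ) * Complex.exp (-(Complex.I * (phase u y : ℂ)))) :
    z ∈ region Pi ↔ IQC Pi u y := by
  have hu' : 0 < ‖u‖ ^ 2 := by positivity
  have hg : 0 ≤ gain u y := div_nonneg (norm_nonneg _) (norm_nonneg _)
  have hn : ‖z‖ = gain u y := by
    rcases hz with rfl | rfl <;> simp [Complex.norm_exp, abs_of_nonneg hg]
  have hr : z.re = gain u y * Real.cos (phase u y) := by
    rcases hz with rfl | rfl <;> simp [Complex.exp_re]
  have hgy : gain u y ^ 2 * ‖u‖ ^ 2 = ‖y‖ ^ 2 := by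
    rw [gain, div_pow, div_mul_cancel₀ _ hu'.ne']
  rw [mem_region_iff, iqc_iff_totalSupply_nonneg, totalSupply_apply, hn, hr,
    real_inner_self_eq_norm_sq, real_inner_self_eq_norm_sq, ← gain_mul_cos_phase hu y, ← hgy,
    ← mul_nonneg_iff_of_pos_right hu']
  ring_nf

theorem sg_subset_region_iff {n : ℕ} (Pi : Matrix (Fin 2) (Fin 2) ℝ) (H : System n) :
    SG H ⊆ region Pi ↔ ∀ u ≠ 0, ∀ y ∈ H u, IQC Pi u y := by
  constructor
  · intro h u hu y hy
    exact (mem_region_iff_iqc Pi hu y (Or.inl rfl)).1 (h ⟨u, ⟨mem_univ u, hu⟩, y, hy, Or.inl rfl⟩)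
  · rintro h z ⟨u, ⟨-, hu⟩, y, hy, hz⟩
    exact (mem_region_iff_iqc Pi hu y hz).2 (h u hu y hy)

/-! ### Uniqueness for the zero input -/

theorem IsStateTrajectory.eq_zero {m n : ℕ} {A : Matrix (Fin m) (Fin m) ℝ}
    {B : Matrix (Fin m) (Fin n) ℝ} {x : ℝ → Fin m → ℝ}
    (h : IsStateTrajectory A B 0 (0 : L2Signal n) x) {t : ℝ} (ht : 0 ≤ t) : x t = 0 := by
  have hx : ∀ t, 0 ≤ t → x t = ∫ s in (0 : ℝ)..t, A *ᵥ x s := fun t ht => by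
    rw [h.2 t ht, zero_add]
    apply intervalIntegral.integral_congr_ae
    have h0 := (ae_restrict_iff' measurableSet_Ici).1
      (Lp.coeFn_zero (EuclideanSpace ℝ (Fin n)) 2 halfLine)
    filter_upwards [h0] with s hs hst
    rw [uIoc_of_le ht] at hst
    rw [hs hst.1.le]
    simp
  have hAx : ContinuousOn (fun s => A *ᵥ x s) (Ici 0) :=
    (continuous_mulVec A).comp_continuousOn h.1
  let K := LinearMap.toContinuousLinearMap A.mulVecLin
  have huniq := ODE_solution_unique_of_mem_Icc_right (v := fun _ => K) (K := ‖K‖₊)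
    (s := fun _ => univ) (f := x) (g := fun _ => 0) (a := 0) (b := t)
    (fun _ _ => K.lipschitz.lipschitzOnWith) (h.1.mono Icc_subset_Ici_self)
    (fun s hs => by
      have hd : HasDerivWithinAt (fun r => ∫ s in (0 : ℝ)..r, A *ᵥ x s) (A *ᵥ x s) (Ici s) s := by
        have hc : ContinuousOn (fun s => A *ᵥ x s) (Ioi s) :=
          hAx.mono fun r hr => hs.1.trans (le_of_lt hr)
        refine intervalIntegral.integral_hasDerivWithinAt_right
          (intervalIntegrable_of_continuousOn_Ici hAx le_rfl hs.1) (t := Ioi s) ?_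
          ((hAx s hs.1).mono fun r hr => hs.1.trans (le_of_lt hr))
        exact ⟨Ioi s, self_mem_nhdsWithin, hc.aestronglyMeasurable measurableSet_Ioi⟩
      exact hd.congr (fun r hr => hx r (hs.1.trans hr)) (hx s hs.1))
    (fun _ _ => mem_univ _) continuousOn_const
    (fun s _ => by simpa using hasDerivWithinAt_const s (Ici s) (0 : Fin m → ℝ))
    (fun _ _ => mem_univ _) (by simpa using h.2 0 le_rfl)
  exact huniq ⟨ht, le_rfl⟩

theorem LTI.output_eq_zero {m n : ℕ} (L : LTI m n) {y : L2Signal n} (hy : y ∈ L.toSystem 0) :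
    y = 0 := by
  obtain ⟨x, hx, hyx⟩ := hy
  rw [Lp.eq_zero_iff_ae_eq_zero]
  filter_upwards [hyx, Lp.coeFn_zero (EuclideanSpace ℝ (Fin n)) 2 halfLine,
    ae_restrict_mem measurableSet_Ici] with t h1 h2 h3
  have h : (y t).ofLp = 0 := by
    rw [h1, h2, hx.eq_zero h3]
    simp
  exact (WithLp.ofLp_eq_zero 2).1 h

theorem LTI.iqc_iff_sg_subset_region {m n : ℕ} (L : LTI m n) (Pi : Matrix (Fin 2) (Fin 2) ℝ) :
    (∀ u, ∀ y ∈ L.toSystem u, IQC Pi u y) ↔ SG L.toSystem ⊆ region Pi := by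
  rw [sg_subset_region_iff]
  refine ⟨fun h u _ => h u, fun h u y hy => ?_⟩
  by_cases hu : u = 0
  · subst hu
    rw [L.output_eq_zero hy, iqc_iff_totalSupply_nonneg]
    simp [totalSupply_apply]
  · exact h u hu y hy

/-! ### The linear matrix inequality as a dissipation inequality -/

/-- The supply rate at the state `x` and the input `u`. -/
def LTI.supply {m n : ℕ} (L : LTI m n) (Pi : Matrix (Fin 2) (Fin 2) ℝ) (x : Fin m → ℝ)
    (u : EuclideanSpace ℝ (Fin n)) : ℝ :=
  supplyRate Pi u (WithLp.toLp 2 (L.C *ᵥ x + L.D *ᵥ u.ofLp))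

/-- The derivative of `xᵀ P x` along a trajectory with velocity `v` at `x`. -/
def storageRate {m : ℕ} (P : Matrix (Fin m) (Fin m) ℝ) (x v : Fin m → ℝ) : ℝ :=
  v ⬝ᵥ (P *ᵥ x) + x ⬝ᵥ (P *ᵥ v)

theorem LTI.dotProduct_kypMatrix_mulVec {m n : ℕ} (L : LTI m n) (Pi : Matrix (Fin 2) (Fin 2) ℝ)
    (P : Matrix (Fin m) (Fin m) ℝ) (x : Fin m → ℝ) (u : EuclideanSpace ℝ (Fin n)) :
    Sum.elim x u.ofLp ⬝ᵥ (L.kypMatrix Pi P *ᵥ Sum.elim x u.ofLp) =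
      storageRate P x (L.A *ᵥ x + L.B *ᵥ u.ofLp) - L.supply Pi x u := by
  have h1 : L.stateBlock *ᵥ Sum.elim x u.ofLp = Sum.elim (L.A *ᵥ x + L.B *ᵥ u.ofLp) x := by
    simp [LTI.stateBlock, Matrix.fromBlocks_mulVec]
  have h2 : L.outputBlock *ᵥ Sum.elim x u.ofLp =
      Sum.elim (L.C *ᵥ x + L.D *ᵥ u.ofLp) u.ofLp := by
    simp [LTI.outputBlock, Matrix.fromBlocks_mulVec]
  have h3 {ι κ : Type} [Fintype ι] [Fintype κ] (S : Matrix κ ι ℝ) (M : Matrix κ κ ℝ) (v : ι → ℝ) :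
      v ⬝ᵥ ((Sᵀ * M * S) *ᵥ v) = (S *ᵥ v) ⬝ᵥ (M *ᵥ (S *ᵥ v)) := by
    rw [← Matrix.mulVec_mulVec, ← Matrix.mulVec_mulVec, Matrix.dotProduct_mulVec v,
      Matrix.vecMul_transpose]
  rw [LTI.kypMatrix, LTI.Theta, Matrix.sub_mulVec, dotProduct_sub, h3, h3, h1, h2]
  congr 1
  simp [Matrix.fromBlocks_mulVec, sumElim_dotProduct_sumElim, storageRate]

/-- Semidefiniteness here includes symmetry of the matrix, which the quadratic form does not see; it
comes from the symmetry of `Π` and `P`. -/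
theorem LTI.negSemidef_kypMatrix_iff {m n : ℕ} (L : LTI m n) {Pi : Matrix (Fin 2) (Fin 2) ℝ}
    (hPi : Pi.IsSymm) {P : Matrix (Fin m) (Fin m) ℝ} (hP : P.IsSymm) :
    NegSemidef (L.kypMatrix Pi P) ↔ ∀ (x : Fin m → ℝ) (u : EuclideanSpace ℝ (Fin n)),
      storageRate P x (L.A *ᵥ x + L.B *ᵥ u.ofLp) ≤ L.supply Pi x u := by
  constructor
  · intro h x u
    have h1 := h.dotProduct_mulVec_nonneg (Sum.elim x u.ofLp)
    rw [star_trivial, Matrix.neg_mulVec, dotProduct_neg, L.dotProduct_kypMatrix_mulVec] at h1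
    linarith
  · intro h
    have hk : (kronId n Pi)ᵀ = kronId n Pi := by
      simp [kronId_eq_fromBlocks, Matrix.fromBlocks_transpose, hPi.apply 0 1]
    refine Matrix.PosSemidef.of_dotProduct_mulVec_nonneg ?_ fun z => ?_
    · rw [Matrix.IsHermitian, Matrix.conjTranspose_eq_transpose_of_trivial, LTI.kypMatrix, LTI.Theta]
      simp only [Matrix.transpose_neg, Matrix.transpose_sub, Matrix.transpose_mul,
        Matrix.transpose_transpose, hk, Matrix.fromBlocks_transpose, Matrix.transpose_zero, hP.eq,
        Matrix.mul_assoc]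
    · have hz : z = Sum.elim (z ∘ Sum.inl) (WithLp.toLp 2 (z ∘ Sum.inr) :
          EuclideanSpace ℝ (Fin n)).ofLp := by simp
      rw [hz, star_trivial, Matrix.neg_mulVec, dotProduct_neg, L.dotProduct_kypMatrix_mulVec]
      linarith [h (z ∘ Sum.inl) (WithLp.toLp 2 (z ∘ Sum.inr))]

/-! ### Trajectories on a bounded interval -/

/-- `x` solves `x' = A x + B u`, `x 0 = x₀` on `[0, T]`, and `u` is square-integrable there. -/
structure IsStateSegment {m n : ℕ} (A : Matrix (Fin m) (Fin m) ℝ) (B : Matrix (Fin m) (Fin n) ℝ)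
    (T : ℝ) (x₀ : Fin m → ℝ) (u : ℝ → EuclideanSpace ℝ (Fin n)) (x : ℝ → Fin m → ℝ) : Prop where
  memLp : MemLp u 2 (volume.restrict (Icc 0 T))
  continuousOn : ContinuousOn x (Icc 0 T)
  eq_add_integral : ∀ t ∈ Icc 0 T,
    x t = x₀ + ∫ s in (0 : ℝ)..t, (A *ᵥ x s + B *ᵥ (u s).ofLp)

section
variable {m n : ℕ} {A : Matrix (Fin m) (Fin m) ℝ} {B : Matrix (Fin m) (Fin n) ℝ} {T : ℝ}
  {x₀ : Fin m → ℝ} {x : ℝ → Fin m → ℝ}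

theorem IsStateTrajectory.isStateSegment {u : L2Signal n} (h : IsStateTrajectory A B x₀ u x)
    (T : ℝ) : IsStateSegment A B T x₀ u x where
  memLp := (Lp.memLp u).mono_measure (Measure.restrict_mono Icc_subset_Ici_self le_rfl)
  continuousOn := h.1.mono Icc_subset_Ici_self
  eq_add_integral t ht := h.2 t ht.1

theorem IsStateSegment.intervalIntegrable {u : ℝ → EuclideanSpace ℝ (Fin n)}
    (h : IsStateSegment A B T x₀ u x) (hT : 0 ≤ T) :
    IntervalIntegrable (fun s => A *ᵥ x s + B *ᵥ (u s).ofLp) volume 0 T := by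
  refine intervalIntegrable_state_rhs A B (by rw [uIcc_of_le hT]; exact h.continuousOn) ?_
  rw [intervalIntegrable_iff, uIoc_of_le hT]
  exact IntegrableOn.mono_set (t := Icc 0 T) (h.memLp.integrable (by norm_num)) Ioc_subset_Icc_self

theorem storageRate_eq_sum (P : Matrix (Fin m) (Fin m) ℝ) (x v : Fin m → ℝ) :
    storageRate P x v = ∑ i, ∑ j, P i j * (v i * x j + x i * v j) := by
  simp only [storageRate, dotProduct, Matrix.mulVec, Finset.mul_sum, mul_add,
    Finset.sum_add_distrib]
  congr 1 <;> exact Finset.sum_congr rfl fun i _ => Finset.sum_congr rfl fun j _ => by ring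

theorem IsStateSegment.storage_intervalIntegral {u : ℝ → EuclideanSpace ℝ (Fin n)}
    (h : IsStateSegment A B T x₀ u x) (hT : 0 ≤ T) (P : Matrix (Fin m) (Fin m) ℝ) :
    IntervalIntegrable (fun t => storageRate P (x t) (A *ᵥ x t + B *ᵥ (u t).ofLp)) volume 0 T ∧
      ∫ t in (0 : ℝ)..T, storageRate P (x t) (A *ᵥ x t + B *ᵥ (u t).ofLp) =
        x T ⬝ᵥ (P *ᵥ x T) - x₀ ⬝ᵥ (P *ᵥ x₀) := by
  set f := fun s => A *ᵥ x s + B *ᵥ (u s).ofLp with hf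
  have hfi : IntervalIntegrable f volume 0 T := h.intervalIntegrable hT
  have hfi' (i : Fin m) := pi_intervalIntegrable_apply hfi i
  have hx (i : Fin m) (t : ℝ) (ht : t ∈ Icc 0 T) : x t i = x₀ i + ∫ s in (0 : ℝ)..t, f s i := by
    have hsub : uIcc 0 t ⊆ uIcc 0 T := by
      rw [uIcc_of_le ht.1, uIcc_of_le hT]; exact Icc_subset_Icc_right ht.2
    rw [← pi_intervalIntegral_apply (hfi.mono_set hsub)]
    exact congrFun (h.eq_add_integral t ht) i
  have hc (i : Fin m) : ContinuousOn (fun t => x t i) (uIcc 0 T) := by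
    rw [uIcc_of_le hT]
    exact (continuous_apply i).comp_continuousOn h.continuousOn
  have hij (i j : Fin m) :
      IntervalIntegrable (fun t => P i j * (f t i * x t j + x t i * f t j)) volume 0 T :=
    (((hfi' i).mul_continuousOn (hc j)).add ((hfi' j).continuousOn_mul (hc i))).const_mul _
  have hi (i : Fin m) : IntervalIntegrable
      (fun t => ∑ j, P i j * (f t i * x t j + x t i * f t j)) volume 0 T := by
    convert! IntervalIntegrable.sum Finset.univ fun j _ => hij i j using 1
    ext t
    simp
  have hfun : (fun t => storageRate P (x t) (f t)) =
      fun t => ∑ i, ∑ j, P i j * (f t i * x t j + x t i * f t j) :=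
    funext fun t => storageRate_eq_sum P (x t) (f t)
  change IntervalIntegrable (fun t => storageRate P (x t) (f t)) volume 0 T ∧
    ∫ t in (0 : ℝ)..T, (fun t => storageRate P (x t) (f t)) t = _
  rw [hfun]
  constructor
  · convert! IntervalIntegrable.sum Finset.univ fun i _ => hi i using 1
    ext t
    simp
  · rw [intervalIntegral.integral_finsetSum fun i _ => hi i]
    simp only [intervalIntegral.integral_finsetSum fun j _ => hij _ j,
      intervalIntegral.integral_const_mul,
      intervalIntegral_mul_add_mul hT (hfi' _) (hfi' _) (hx _) (hx _)]
    simp only [dotProduct, Matrix.mulVec, Finset.mul_sum, mul_sub, Finset.sum_sub_distrib]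
    congr 1 <;> exact Finset.sum_congr rfl fun i _ => Finset.sum_congr rfl fun j _ => by ring

theorem integrable_dotProduct_mulVec {μ : Measure ℝ} (hx : MemLp x 2 μ)
    (P : Matrix (Fin m) (Fin m) ℝ) : Integrable (fun t => x t ⬝ᵥ (P *ᵥ x t)) μ := by
  have hi (i : Fin m) : MemLp (fun t => x t i) 2 μ :=
    (ContinuousLinearMap.proj (R := ℝ) (φ := fun _ : Fin m => ℝ) i).comp_memLp' hx
  simp only [dotProduct, Matrix.mulVec]
  refine integrable_finsetSum _ fun i _ => (hi i).integrable_mul (p := 2) (q := 2) ?_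
  exact memLp_finsetSum _ fun j _ => (hi j).const_mul _

end

/-! ### The matrix inequality implies the integral quadratic constraint -/

theorem supplyRate_eq_supply {m n : ℕ} (L : LTI m n) (Pi : Matrix (Fin 2) (Fin 2) ℝ)
    {u y : EuclideanSpace ℝ (Fin n)} {x : Fin m → ℝ} (h : y.ofLp = L.C *ᵥ x + L.D *ᵥ u.ofLp) :
    supplyRate Pi u y = L.supply Pi x u := by
  rw [LTI.supply, ← h, WithLp.toLp_ofLp]

/-- Applied to `V = xᵀPx`, this replaces a proof that `x(T)` tends to `0`. -/
theorem not_integrableOn_Ici_of_le_neg {V : ℝ → ℝ} {c : ℝ} (hc : c < 0)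
    (hV : ∀ᶠ t in Filter.atTop, V t ≤ c) : ¬ IntegrableOn V (Ici 0) := by
  intro hi
  obtain ⟨T, hT⟩ := (hV.and (Filter.eventually_ge_atTop 0)).exists_forall_of_atTop
  have h1 : IntegrableOn (fun _ : ℝ => c) (Ici T) := by
    refine Integrable.mono (hi.mono_set (Ici_subset_Ici.2 (hT T le_rfl).2))
      aestronglyMeasurable_const ?_
    filter_upwards [ae_restrict_mem measurableSet_Ici] with t ht
    have := (hT t ht).1
    rw [Real.norm_eq_abs, Real.norm_eq_abs, abs_of_neg hc, abs_of_neg (by linarith)]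
    linarith
  rw [integrableOn_const_iff] at h1
  simp [hc.ne] at h1

theorem LTI.iqc_of_negSemidef_kypMatrix {m n : ℕ} (L : LTI m n) (hA : IsHurwitz L.A)
    {Pi : Matrix (Fin 2) (Fin 2) ℝ} (hPi : Pi.IsSymm) {P : Matrix (Fin m) (Fin m) ℝ}
    (hP : P.IsSymm) (h : NegSemidef (L.kypMatrix Pi P)) {u y : L2Signal n}
    (hy : y ∈ L.toSystem u) : IQC Pi u y := by
  rw [L.negSemidef_kypMatrix_iff hPi hP] at h
  obtain ⟨x, hx, hyx⟩ := hy
  have hint := integrable_supplyRate Pi u y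
  have hle (T : ℝ) (hT : 0 ≤ T) :
      x T ⬝ᵥ (P *ᵥ x T) ≤ ∫ t in (0 : ℝ)..T, supplyRate Pi (u t) (y t) := by
    obtain ⟨hi, he⟩ := (hx.isStateSegment T).storage_intervalIntegral hT P
    rw [zero_dotProduct, sub_zero] at he
    rw [← he]
    refine intervalIntegral.integral_mono_ae_restrict hT hi ?_ ?_
    · rw [intervalIntegrable_iff, uIoc_of_le hT]
      exact IntegrableOn.mono_set (t := Ici 0) hint fun t ht => ht.1.le
    · have := ae_restrict_of_ae_restrict_of_subset (s := Icc 0 T)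
        (fun t ht => ht.1) hyx
      filter_upwards [this] with t ht
      rw [supplyRate_eq_supply L Pi ht]
      exact h _ _
  by_contra hneg
  rw [IQC, not_le] at hneg
  have hlim := intervalIntegral_tendsto_integral_Ioi (μ := volume) 0
    (IntegrableOn.mono_set (t := Ici 0) hint Ioi_subset_Ici_self) Filter.tendsto_id
  rw [← integral_Ici_eq_integral_Ioi] at hlim
  set c := ∫ t in Ici (0 : ℝ), supplyRate Pi (u t) (y t)
  -- If the total supply `c` were negative, the partial integrals, and with them `xᵀPx`, would
  -- eventually be at most `c / 2 < 0`.
  refine not_integrableOn_Ici_of_le_neg (c := c / 2) (by linarith) ?_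
    (integrable_dotProduct_mulVec (hx.memLp_two hA) P)
  filter_upwards [hlim.eventually_le_const (show c < c / 2 by linarith),
    Filter.eventually_ge_atTop 0] with T h1 h2
  exact (hle T h2).trans h1

/-! ### Concatenation -/

/-- The function equal to `f` before time `T` and to `g`, restarted, from `T` on. -/
def concat {E : Type*} (T : ℝ) (f g : ℝ → E) (t : ℝ) : E := if t < T then f t else g (t - T)

section
variable {E : Type*} {T t : ℝ} {f g : ℝ → E}

theorem concat_of_lt (ht : t < T) : concat T f g t = f t := if_pos ht

theorem concat_of_ge (ht : T ≤ t) : concat T f g t = g (t - T) := if_neg ht.not_gt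

theorem measurePreserving_sub_restrict_Ici (T : ℝ) :
    MeasurePreserving (fun t : ℝ => t - T) (volume.restrict (Ici T)) halfLine := by
  have h := (measurePreserving_sub_right (volume : Measure ℝ) T).restrict_preimage
    (measurableSet_Ici (a := (0 : ℝ)))
  simpa using h

theorem Ico_union_Ici_zero (hT : 0 ≤ T) : Ico 0 T ∪ Ici T = Ici 0 := Ico_union_Ici_eq_Ici hT

variable [NormedAddCommGroup E]

theorem memLp_concat {p : ENNReal} (hf : MemLp f p (volume.restrict (Icc 0 T)))
    (hg : MemLp g p halfLine) : MemLp (concat T f g) p halfLine := by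
  have h1 : MemLp ((Iio T).indicator f) p halfLine := by
    rw [memLp_indicator_iff_restrict measurableSet_Iio, Measure.restrict_restrict measurableSet_Iio]
    exact hf.mono_measure (Measure.restrict_mono
      (show Iio T ∩ Ici 0 ⊆ Icc 0 T from fun t ht => ⟨ht.2, le_of_lt ht.1⟩) le_rfl)
  have h2 : MemLp ((Ici T).indicator fun t => g (t - T)) p halfLine := by
    rw [memLp_indicator_iff_restrict measurableSet_Ici, Measure.restrict_restrict measurableSet_Ici]
    exact (hg.comp_measurePreserving (measurePreserving_sub_restrict_Ici T)).mono_measure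
      (Measure.restrict_mono inter_subset_left le_rfl)
  convert! h1.add h2 using 1
  ext t
  by_cases ht : t < T
  · simp [concat, ht]
  · simp [concat, ht, not_lt.1 ht]

variable [NormedSpace ℝ E]

theorem integral_Ici_concat {f g : ℝ → E} (hT : 0 ≤ T)
    (h : IntegrableOn (concat T f g) (Ici 0)) :
    ∫ t in Ici 0, concat T f g t = (∫ t in (0 : ℝ)..T, f t) + ∫ t in Ici 0, g t := by
  rw [← Ico_union_Ici_zero hT] at h ⊢
  have hd : Disjoint (Ico 0 T) (Ici T) :=
    disjoint_left.2 fun t h1 h2 => h1.2.not_ge h2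
  rw [setIntegral_union hd measurableSet_Ici h.left_of_union h.right_of_union,
    Ico_union_Ici_zero hT, intervalIntegral.integral_of_le hT, integral_Ioc_eq_integral_Ioo,
    ← integral_Ico_eq_integral_Ioo]
  congr 1
  · exact setIntegral_congr_fun measurableSet_Ico fun t ht => concat_of_lt ht.2
  · rw [setIntegral_congr_fun measurableSet_Ici fun t ht => concat_of_ge ht]
    exact (measurePreserving_sub_restrict_Ici T).integral_comp
      (measurableEmbedding_subRight T) g

theorem intervalIntegral_concat_of_le {f g : ℝ → E} (ht : 0 ≤ t) (htT : t ≤ T) :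
    ∫ s in (0 : ℝ)..t, concat T f g s = ∫ s in (0 : ℝ)..t, f s := by
  rw [intervalIntegral.integral_of_le ht, intervalIntegral.integral_of_le ht,
    integral_Ioc_eq_integral_Ioo, integral_Ioc_eq_integral_Ioo]
  exact setIntegral_congr_fun measurableSet_Ioo fun s hs => concat_of_lt (hs.2.trans_le htT)

theorem intervalIntegral_concat_of_ge {f g : ℝ → E} (hT : 0 ≤ T) (htT : T ≤ t)
    (hf : IntervalIntegrable f volume 0 T) (hg : IntervalIntegrable g volume 0 (t - T)) :
    ∫ s in (0 : ℝ)..t, concat T f g s =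
      (∫ s in (0 : ℝ)..T, f s) + ∫ s in (0 : ℝ)..(t - T), g s := by
  have h1 : IntervalIntegrable (concat T f g) volume 0 T := by
    rw [intervalIntegrable_iff_integrableOn_Ioo_of_le hT] at hf ⊢
    exact hf.congr_fun (fun s hs => (concat_of_lt hs.2).symm) measurableSet_Ioo
  have hg' : IntervalIntegrable (fun s => g (s - T)) volume T t := by
    have := hg.comp_sub_right T
    simpa using this
  have heq : EqOn (fun s => g (s - T)) (concat T f g) (uIcc T t) := by
    rw [uIcc_of_le htT]
    exact fun s hs => (concat_of_ge hs.1).symm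
  have h2 : IntervalIntegrable (concat T f g) volume T t :=
    hg'.congr (fun s hs => heq (uIoc_subset_uIcc hs))
  rw [← intervalIntegral.integral_add_adjacent_intervals h1 h2,
    intervalIntegral_concat_of_le hT le_rfl, ← intervalIntegral.integral_congr heq]
  simp

end

theorem ContinuousOn.memLp_Icc {E : Type*} [NormedAddCommGroup E]
    {f : ℝ → E} {a b : ℝ} (hf : ContinuousOn f (Icc a b)) (p : ENNReal) :
    MemLp f p (volume.restrict (Icc a b)) := by
  obtain ⟨c, hc⟩ := isCompact_Icc.exists_bound_of_continuousOn hf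
  refine MemLp.of_bound (hf.aestronglyMeasurable_of_isCompact isCompact_Icc measurableSet_Icc) c ?_
  filter_upwards [ae_restrict_mem measurableSet_Icc] with t ht using hc t ht

/-- The output vector `C x + D u`. -/
def LTI.output {m n : ℕ} (L : LTI m n) (x : Fin m → ℝ) (u : EuclideanSpace ℝ (Fin n)) :
    EuclideanSpace ℝ (Fin n) :=
  WithLp.toLp 2 (L.C *ᵥ x + L.D *ᵥ u.ofLp)

theorem LTI.memLp_output {m n : ℕ} (L : LTI m n) {p : ENNReal} {μ : Measure ℝ}
    {x : ℝ → Fin m → ℝ} {u : ℝ → EuclideanSpace ℝ (Fin n)} (hx : MemLp x p μ) (hu : MemLp u p μ) :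
    MemLp (fun t => L.output (x t) (u t)) p μ := by
  have hC := (LinearMap.toContinuousLinearMap L.C.mulVecLin).comp_memLp' hx
  have hD := (mulVecCLM L.D).comp_memLp' hu
  exact ((PiLp.continuousLinearEquiv 2 ℝ (fun _ : Fin n => ℝ)).symm :
    (Fin n → ℝ) →L[ℝ] EuclideanSpace ℝ (Fin n)).comp_memLp' (hC.add hD)

/-- Appending a trajectory on the half-line to a trajectory on `[0, T]`. -/
theorem LTI.exists_concat {m n : ℕ} (L : LTI m n) (Pi : Matrix (Fin 2) (Fin 2) ℝ) {T : ℝ}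
    (hT : 0 ≤ T) {x₀ : Fin m → ℝ} {u₁ : ℝ → EuclideanSpace ℝ (Fin n)} {x₁ x₂ : ℝ → Fin m → ℝ}
    {u₂ y₂ : L2Signal n} (h₁ : IsStateSegment L.A L.B T x₀ u₁ x₁)
    (h₂ : IsStateTrajectory L.A L.B (x₁ T) u₂ x₂)
    (hy₂ : ∀ᵐ t ∂halfLine, (y₂ t).ofLp = L.C *ᵥ x₂ t + L.D *ᵥ (u₂ t).ofLp) :
    ∃ (u y : L2Signal n) (x : ℝ → Fin m → ℝ), IsStateTrajectory L.A L.B x₀ u x ∧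
      (∀ᵐ t ∂halfLine, (y t).ofLp = L.C *ᵥ x t + L.D *ᵥ (u t).ofLp) ∧
      totalSupply n Pi (u, y) =
        (∫ t in (0 : ℝ)..T, L.supply Pi (x₁ t) (u₁ t)) + totalSupply n Pi (u₂, y₂) := by
  have hum := memLp_concat h₁.memLp (Lp.memLp u₂)
  have hym := memLp_concat
    (L.memLp_output (ContinuousOn.memLp_Icc h₁.continuousOn 2) h₁.memLp) (Lp.memLp y₂)
  set u := hum.toLp
  set y := hym.toLp
  have hu : ∀ᵐ t ∂halfLine, u t = concat T u₁ u₂ t := hum.coeFn_toLp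
  have hy : ∀ᵐ t ∂halfLine, y t = concat T (fun t => L.output (x₁ t) (u₁ t)) y₂ t :=
    hym.coeFn_toLp
  have hy₂' : ∀ᵐ t ∂halfLine, T ≤ t →
      (y₂ (t - T)).ofLp = L.C *ᵥ x₂ (t - T) + L.D *ᵥ (u₂ (t - T)).ofLp := by
    have h := (measurePreserving_sub_restrict_Ici T).quasiMeasurePreserving.ae hy₂
    rw [ae_restrict_iff' measurableSet_Ici] at h
    exact ae_restrict_of_ae h
  have hx₂0 : x₂ 0 = x₁ T := by simpa using h₂.2 0 le_rfl
  refine ⟨u, y, concat T x₁ x₂, ⟨?_, fun t ht => ?_⟩, ?_, ?_⟩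
  · rw [← Icc_union_Ici_eq_Ici hT]
    refine ContinuousOn.union_of_isClosed ?_ ?_ isClosed_Icc isClosed_Ici
    · refine h₁.continuousOn.congr fun t ht => ?_
      rcases ht.2.lt_or_eq with h | rfl
      · exact concat_of_lt h
      -- At `t = T` the second branch is active; the two pieces agree there because the second
      -- starts at `x₁ T`.
      · rw [concat_of_ge le_rfl, sub_self, hx₂0]
    · refine ContinuousOn.congr (f := fun t => x₂ (t - T)) ?_ fun t ht => concat_of_ge ht
      exact h₂.1.comp (continuous_id.sub continuous_const).continuousOn
        fun t (ht : T ≤ t) => mem_Ici.2 (sub_nonneg.2 ht)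
  · have hI : ∫ s in (0 : ℝ)..t, (L.A *ᵥ concat T x₁ x₂ s + L.B *ᵥ (u s).ofLp) =
        ∫ s in (0 : ℝ)..t, concat T (fun s => L.A *ᵥ x₁ s + L.B *ᵥ (u₁ s).ofLp)
          (fun s => L.A *ᵥ x₂ s + L.B *ᵥ (u₂ s).ofLp) s := by
      apply intervalIntegral.integral_congr_ae
      filter_upwards [(ae_restrict_iff' measurableSet_Ici).1 hu] with s hs hst
      rw [uIoc_of_le ht] at hst
      rw [hs hst.1.le]
      by_cases h : s < T <;> simp [concat, h]
    rw [hI]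
    rcases lt_or_ge t T with h | h
    · rw [intervalIntegral_concat_of_le ht h.le, concat_of_lt h]
      exact h₁.eq_add_integral t ⟨ht, h.le⟩
    · rw [intervalIntegral_concat_of_ge hT h (h₁.intervalIntegrable hT)
        (h₂.intervalIntegrable (sub_nonneg.2 h)), concat_of_ge h, h₂.2 _ (sub_nonneg.2 h),
        h₁.eq_add_integral T ⟨hT, le_rfl⟩, add_assoc]
  · filter_upwards [hu, hy, hy₂'] with t h1 h2 h3
    rw [h1, h2]
    rcases lt_or_ge t T with h | h
    · simp only [concat_of_lt h, LTI.output]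
    · simp only [concat_of_ge h, h3 h]
  · have he : (fun t => supplyRate Pi (u t) (y t)) =ᵐ[halfLine]
        concat T (fun t => L.supply Pi (x₁ t) (u₁ t)) (fun t => supplyRate Pi (u₂ t) (y₂ t)) := by
      filter_upwards [hu, hy] with t h1 h2
      rw [h1, h2]
      rcases lt_or_ge t T with h | h
      · simp only [concat_of_lt h, LTI.supply, LTI.output]
      · simp only [concat_of_ge h]
    rw [← integral_supplyRate, ← integral_supplyRate, ← integral_Ici_concat hT]
    · exact integral_congr_ae he
    · exact (integrable_congr he).1 (integrable_supplyRate Pi u y)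

/-! ### Solutions for constant inputs -/

theorem exists_hasDerivAt_clm {E : Type*} [NormedAddCommGroup E] [NormedSpace ℝ E]
    [CompleteSpace E] (M : E →L[ℝ] E) (z : E) :
    ∃ x : ℝ → E, x 0 = z ∧ ∀ t, HasDerivAt x (M (x t)) t := by
  refine ⟨fun t => NormedSpace.exp (t • M) z, by simp, fun t => ?_⟩
  simpa using (hasDerivAt_exp_smul_const' M t).clm_apply (hasDerivAt_const t z)

theorem exists_hasDerivAt_constant_input {m n : ℕ} (A : Matrix (Fin m) (Fin m) ℝ)
    (B : Matrix (Fin m) (Fin n) ℝ) (x₀ : Fin m → ℝ) (v : EuclideanSpace ℝ (Fin n)) :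
    ∃ x : ℝ → Fin m → ℝ, x 0 = x₀ ∧ ∀ t, HasDerivAt x (A *ᵥ x t + B *ᵥ v.ofLp) t := by
  -- The constant input becomes an extra state with zero derivative, so the augmented system is
  -- autonomous and solved by an exponential.
  let M : (Fin m → ℝ) × EuclideanSpace ℝ (Fin n) →L[ℝ] (Fin m → ℝ) × EuclideanSpace ℝ (Fin n) :=
    ((LinearMap.toContinuousLinearMap A.mulVecLin).coprod (mulVecCLM B)).prod 0
  obtain ⟨z, hz0, hz⟩ := exists_hasDerivAt_clm M (x₀, v)
  have h1 (t : ℝ) : HasDerivAt (fun t => (z t).1) (A *ᵥ (z t).1 + B *ᵥ (z t).2.ofLp) t :=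
    (hz t).fst
  have h2 (t : ℝ) : HasDerivAt (fun t => (z t).2) 0 t := (hz t).snd
  have h3 (t : ℝ) : (z t).2 = v := by
    have h := is_const_of_deriv_eq_zero (fun t => (h2 t).differentiableAt)
      (fun t => (h2 t).deriv) t 0
    simpa [hz0] using h
  refine ⟨fun t => (z t).1, by simp [hz0], fun t => ?_⟩
  simpa only [h3] using h1 t

theorem eq_add_intervalIntegral_of_hasDerivAt {m n : ℕ} {A : Matrix (Fin m) (Fin m) ℝ}
    {B : Matrix (Fin m) (Fin n) ℝ} {v : EuclideanSpace ℝ (Fin n)} {x : ℝ → Fin m → ℝ}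
    (h : ∀ t, HasDerivAt x (A *ᵥ x t + B *ᵥ v.ofLp) t) (t : ℝ) :
    x t = x 0 + ∫ s in (0 : ℝ)..t, (A *ᵥ x s + B *ᵥ v.ofLp) := by
  have hc : Continuous x := continuous_iff_continuousAt.2 fun t => (h t).continuousAt
  rw [intervalIntegral.integral_eq_sub_of_hasDerivAt (fun s _ => h s)
    (((continuous_mulVec A).comp hc).add continuous_const).continuousOn.intervalIntegrable,
    add_sub_cancel]

theorem isStateSegment_of_hasDerivAt {m n : ℕ} {A : Matrix (Fin m) (Fin m) ℝ}
    {B : Matrix (Fin m) (Fin n) ℝ} {v : EuclideanSpace ℝ (Fin n)} {x : ℝ → Fin m → ℝ}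
    (h : ∀ t, HasDerivAt x (A *ᵥ x t + B *ᵥ v.ofLp) t) (T : ℝ) :
    IsStateSegment A B T (x 0) (fun _ => v) x where
  memLp := memLp_const v
  continuousOn := (continuous_iff_continuousAt.2 fun t => (h t).continuousAt).continuousOn
  eq_add_integral t _ := eq_add_intervalIntegral_of_hasDerivAt h t

theorem exists_isStateTrajectory_zero {m n : ℕ} (A : Matrix (Fin m) (Fin m) ℝ)
    (B : Matrix (Fin m) (Fin n) ℝ) (x₀ : Fin m → ℝ) :
    ∃ x, IsStateTrajectory A B x₀ (0 : L2Signal n) x := by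
  obtain ⟨x, hx0, hx⟩ := exists_hasDerivAt_constant_input A B x₀ 0
  refine ⟨x, (continuous_iff_continuousAt.2 fun t => (hx t).continuousAt).continuousOn,
    fun t ht => ?_⟩
  rw [eq_add_intervalIntegral_of_hasDerivAt hx t, hx0]
  congr 1
  apply intervalIntegral.integral_congr_ae
  have h0 := (ae_restrict_iff' measurableSet_Ici).1
    (Lp.coeFn_zero (EuclideanSpace ℝ (Fin n)) 2 halfLine)
  filter_upwards [h0] with s hs hst
  rw [uIoc_of_le ht] at hst
  rw [hs hst.1.le]
  simp

/-! ### The space of square-integrable behaviours -/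

/-- The triples `(x, u, y)` of a state trajectory with its square-integrable input and output. -/
def LTI.behaviour {m n : ℕ} (L : LTI m n) :
    Submodule ℝ ((ℝ → Fin m → ℝ) × (L2Signal n × L2Signal n)) where
  carrier := {w | IsStateTrajectory L.A L.B (w.1 0) w.2.1 w.1 ∧
    ∀ᵐ t ∂halfLine, (w.2.2 t).ofLp = L.C *ᵥ w.1 t + L.D *ᵥ (w.2.1 t).ofLp}
  zero_mem' := by
    refine ⟨⟨continuousOn_const, fun t ht => ?_⟩, ?_⟩
    · have h0 := (ae_restrict_iff' measurableSet_Ici).1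
        (Lp.coeFn_zero (EuclideanSpace ℝ (Fin n)) 2 halfLine)
      rw [intervalIntegral.integral_zero_ae]
      · simp
      · filter_upwards [h0] with s hs hst
        rw [uIoc_of_le ht] at hst
        have := hs hst.1.le
        simp only [Prod.snd_zero, Prod.fst_zero]
        rw [this]
        simp
    · filter_upwards [Lp.coeFn_zero (EuclideanSpace ℝ (Fin n)) 2 halfLine] with t ht
      simp only [Prod.snd_zero, Prod.fst_zero]
      rw [ht]
      simp
  add_mem' := by
    rintro ⟨x, u, y⟩ ⟨x', u', y'⟩ ⟨⟨hc, hx⟩, hy⟩ ⟨⟨hc', hx'⟩, hy'⟩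
    refine ⟨⟨hc.add hc', fun t ht => ?_⟩, ?_⟩
    · have e1 := hx t ht
      have e2 := hx' t ht
      dsimp only [Prod.mk_add_mk, Pi.add_apply] at e1 e2 ⊢
      rw [e1, e2, add_add_add_comm, ← intervalIntegral.integral_add
        (IsStateTrajectory.intervalIntegrable ⟨hc, hx⟩ ht)
        (IsStateTrajectory.intervalIntegrable ⟨hc', hx'⟩ ht)]
      congr 1
      apply intervalIntegral.integral_congr_ae
      filter_upwards [(ae_restrict_iff' measurableSet_Ici).1 (Lp.coeFn_add u u')] with s hs hst
      rw [uIoc_of_le ht] at hst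
      rw [hs hst.1.le, Pi.add_apply, WithLp.ofLp_add, Matrix.mulVec_add, Matrix.mulVec_add]
      abel
    · filter_upwards [hy, hy', Lp.coeFn_add u u', Lp.coeFn_add y y'] with t h1 h2 h3 h4
      dsimp only [Prod.mk_add_mk, Pi.add_apply] at h1 h2 ⊢
      rw [h3, h4, Pi.add_apply, Pi.add_apply, WithLp.ofLp_add, WithLp.ofLp_add, h1, h2,
        Matrix.mulVec_add, Matrix.mulVec_add]
      abel
  smul_mem' := by
    rintro c ⟨x, u, y⟩ ⟨⟨hc, hx⟩, hy⟩
    refine ⟨⟨hc.const_smul c, fun t ht => ?_⟩, ?_⟩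
    · have e1 := hx t ht
      dsimp only [Prod.smul_mk, Pi.smul_apply] at e1 ⊢
      rw [e1, smul_add, ← intervalIntegral.integral_smul]
      congr 1
      apply intervalIntegral.integral_congr_ae
      filter_upwards [(ae_restrict_iff' measurableSet_Ici).1 (Lp.coeFn_smul c u)] with s hs hst
      rw [uIoc_of_le ht] at hst
      rw [hs hst.1.le, Pi.smul_apply, WithLp.ofLp_smul, Matrix.mulVec_smul, Matrix.mulVec_smul,
        smul_add]
    · filter_upwards [hy, Lp.coeFn_smul c u, Lp.coeFn_smul c y] with t h1 h3 h4
      dsimp only [Prod.smul_mk, Pi.smul_apply] at h1 ⊢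
      rw [h3, h4, Pi.smul_apply, Pi.smul_apply, WithLp.ofLp_smul, WithLp.ofLp_smul, h1,
        Matrix.mulVec_smul, Matrix.mulVec_smul, smul_add]

/-- The initial state of a behaviour. -/
def LTI.initialState {m n : ℕ} (L : LTI m n) : L.behaviour →ₗ[ℝ] (Fin m → ℝ) :=
  LinearMap.proj 0 ∘ₗ LinearMap.fst ℝ _ _ ∘ₗ L.behaviour.subtype

/-- The integrated supply rate of a behaviour. -/
def LTI.behaviourSupply {m n : ℕ} (L : LTI m n) (Pi : Matrix (Fin 2) (Fin 2) ℝ) :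
    QuadraticForm ℝ L.behaviour :=
  (totalSupply n Pi).comp (LinearMap.snd ℝ _ _ ∘ₗ L.behaviour.subtype)

/-- The zero input suffices: stability makes the free response, and hence its output,
square-integrable. -/
theorem LTI.initialState_surjective {m n : ℕ} (L : LTI m n) (hA : IsHurwitz L.A) :
    Function.Surjective L.initialState := by
  intro x₀
  obtain ⟨x, hx⟩ := exists_isStateTrajectory_zero L.A L.B x₀
  have hx0 : x 0 = x₀ := by simpa using hx.2 0 le_rfl
  have hym := L.memLp_output (hx.memLp_two hA) (Lp.memLp (0 : L2Signal n))
  refine ⟨⟨(x, 0, hym.toLp), by rw [← hx0] at hx; exact hx, ?_⟩, hx0⟩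
  filter_upwards [hym.coeFn_toLp] with t ht
  rw [ht]
  rfl

/-- Prefixing a trajectory segment to a behaviour. -/
theorem LTI.exists_prefix {m n : ℕ} (L : LTI m n) (Pi : Matrix (Fin 2) (Fin 2) ℝ) {T : ℝ}
    (hT : 0 ≤ T) {x₀ : Fin m → ℝ} {u₁ : ℝ → EuclideanSpace ℝ (Fin n)} {x₁ : ℝ → Fin m → ℝ}
    (h₁ : IsStateSegment L.A L.B T x₀ u₁ x₁) (w : L.behaviour) (hw : L.initialState w = x₁ T) :
    ∃ w' : L.behaviour, L.initialState w' = x₀ ∧ L.behaviourSupply Pi w' =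
      (∫ t in (0 : ℝ)..T, L.supply Pi (x₁ t) (u₁ t)) + L.behaviourSupply Pi w := by
  obtain ⟨⟨x₂, u₂, y₂⟩, h₂, hy₂⟩ := w
  have hw' : x₂ 0 = x₁ T := hw
  dsimp only at h₂ hy₂
  rw [hw'] at h₂
  obtain ⟨u, y, x, hx, hy, he⟩ := L.exists_concat Pi hT h₁ h₂ hy₂
  have hx0 : x 0 = x₀ := by simpa using hx.2 0 le_rfl
  exact ⟨⟨(x, u, y), by rw [← hx0] at hx; exact hx, hy⟩, hx0, he⟩

/-! ### The integral quadratic constraint implies the matrix inequality -/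

/-- `S` is the optimal cost of going from a state to infinity. The inequality is Bellman's
principle: a segment followed by any behaviour from its endpoint competes in the infimum at its
start. -/
theorem LTI.exists_quadratic_storage {m n : ℕ} (L : LTI m n) (hA : IsHurwitz L.A)
    (hAB : IsControllable L.A L.B) {Pi : Matrix (Fin 2) (Fin 2) ℝ}
    (h : ∀ u, ∀ y ∈ L.toSystem u, IQC Pi u y) :
    ∃ S : QuadraticForm ℝ (Fin m → ℝ), ∀ (T : ℝ) (x₀ : Fin m → ℝ)
      (u : ℝ → EuclideanSpace ℝ (Fin n)) (x : ℝ → Fin m → ℝ), 0 ≤ T →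
      IsStateSegment L.A L.B T x₀ u x →
      S x₀ ≤ (∫ t in (0 : ℝ)..T, L.supply Pi (x t) (u t)) + S (x T) := by
  obtain ⟨S, hS⟩ := exists_quadraticForm_isGLB (L.behaviourSupply Pi) L.initialState
    (L.initialState_surjective hA) (fun v => by
      -- The lower bound at `v` is minus the supply spent in steering `0` to `v`: the concatenated
      -- trajectory starts at `0`, so the constraint applies to it.
      obtain ⟨T, hT, u, x, hx, rfl⟩ := hAB 0 v
      refine ⟨-∫ t in (0 : ℝ)..T, L.supply Pi (x t) (u t), ?_⟩
      rintro _ ⟨w, hw, rfl⟩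
      obtain ⟨⟨⟨x', u', y'⟩, hx', hy'⟩, h0, he⟩ :=
        L.exists_prefix Pi hT.le (hx.isStateSegment T) w hw
      have h0' : x' 0 = 0 := h0
      dsimp only at hx' hy'
      rw [h0'] at hx'
      have hn := (iqc_iff_totalSupply_nonneg Pi u' y').1 (h u' y' ⟨x', hx', hy'⟩)
      change totalSupply n Pi (u', y') = _ at he
      linarith)
  refine ⟨S, fun T x₀ u x hT hx => ?_⟩
  have hle : S x₀ - ∫ t in (0 : ℝ)..T, L.supply Pi (x t) (u t) ≤ S (x T) := by
    refine (hS (x T)).2 ?_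
    rintro _ ⟨w, hw, rfl⟩
    obtain ⟨w', h0, he⟩ := L.exists_prefix Pi hT hx w hw
    have := (hS x₀).1 ⟨w', h0, rfl⟩
    linarith
  linarith

theorem nonneg_of_forall_intervalIntegral_nonneg {h : ℝ → ℝ} (hc : Continuous h)
    (hi : ∀ T, 0 ≤ T → 0 ≤ ∫ t in (0 : ℝ)..T, h t) : 0 ≤ h 0 := by
  by_contra! hneg
  obtain ⟨δ, hδ, hb⟩ := Metric.eventually_nhds_iff.1
    (hc.continuousAt.eventually_lt continuousAt_const (show h 0 < h 0 / 2 by linarith))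
  have h1 := intervalIntegral.integral_mono_on (half_pos hδ).le (hc.intervalIntegrable 0 (δ / 2))
    (intervalIntegrable_const (c := h 0 / 2) (μ := volume)) (fun t ht => (hb (by
      rw [Real.dist_eq, sub_zero, abs_of_nonneg ht.1]
      linarith [ht.2])).le)
  have h2 := hi (δ / 2) (half_pos hδ).le
  rw [intervalIntegral.integral_const, sub_zero, smul_eq_mul] at h1
  nlinarith

theorem LTI.exists_negSemidef_kypMatrix {m n : ℕ} (L : LTI m n) (hA : IsHurwitz L.A)
    (hAB : IsControllable L.A L.B) {Pi : Matrix (Fin 2) (Fin 2) ℝ} (hPi : Pi.IsSymm)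
    (h : ∀ u, ∀ y ∈ L.toSystem u, IQC Pi u y) :
    ∃ P : Matrix (Fin m) (Fin m) ℝ, P.IsSymm ∧ NegSemidef (L.kypMatrix Pi P) := by
  obtain ⟨S, hS⟩ := L.exists_quadratic_storage hA hAB h
  have hP : (-S.toMatrix').IsSymm := S.isSymm_toMatrix'.neg
  have hSP (x : Fin m → ℝ) : S x = -(x ⬝ᵥ (-S.toMatrix' *ᵥ x)) := by
    rw [Matrix.neg_mulVec, dotProduct_neg, neg_neg, QuadraticForm.toMatrix',
      ← Matrix.toLinearMap₂'_apply', Matrix.toLinearMap₂'_toMatrix']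
    exact (QuadraticMap.associated_eq_self_apply ℝ S x).symm
  refine ⟨_, hP, (L.negSemidef_kypMatrix_iff hPi hP).2 fun x₀ v => ?_⟩
  set P := -S.toMatrix'
  -- A constant input makes both rates continuous in time, so the integrated inequality over short
  -- intervals yields the pointwise one at time `0`, where the state `x₀` and the input `v` are
  -- arbitrary.
  obtain ⟨x, rfl, hx⟩ := exists_hasDerivAt_constant_input L.A L.B x₀ v
  have hxc : Continuous x := continuous_iff_continuousAt.2 fun t => (hx t).continuousAt
  have hc1 : Continuous fun t => storageRate P (x t) (L.A *ᵥ x t + L.B *ᵥ v.ofLp) := by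
    unfold storageRate
    fun_prop
  have hc2 : Continuous fun t => L.supply Pi (x t) v := by
    simp only [LTI.supply, supplyRate_eq_inner]
    fun_prop
  have hfin := nonneg_of_forall_intervalIntegral_nonneg (hc2.sub hc1) fun T hT => by
    have hseg := isStateSegment_of_hasDerivAt hx T
    have h1 := hS T _ _ x hT hseg
    have h2 := (hseg.storage_intervalIntegral hT P).2
    rw [hSP, hSP] at h1
    have h3 := intervalIntegral.integral_sub (hc2.intervalIntegrable 0 T)
      (hc1.intervalIntegrable 0 T) (μ := volume)
    change 0 ≤ ∫ t in (0 : ℝ)..T, (L.supply Pi (x t) v -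
      storageRate P (x t) (L.A *ᵥ x t + L.B *ᵥ v.ofLp))
    linarith
  exact sub_nonneg.1 hfin

end ScaledGraph

end


theorem mainTheorem2 (m n : ℕ) (L : ScaledGraph.LTI m n) (hA : ScaledGraph.IsHurwitz L.A)
    (Pi : Matrix (Fin 2) (Fin 2) ℝ) (hPi : Pi.IsSymm) :
    ((∃ P : Matrix (Fin m) (Fin m) ℝ, P.IsSymm ∧ ScaledGraph.NegSemidef (L.kypMatrix Pi P)) →
      ∀ u, ∀ y ∈ L.toSystem u, ScaledGraph.IQC Pi u y) ∧
    ((∃ P : Matrix (Fin m) (Fin m) ℝ, P.IsSymm ∧ ScaledGraph.NegSemidef (L.kypMatrix Pi P)) →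
      ScaledGraph.SG L.toSystem ⊆ ScaledGraph.region Pi) ∧
    ((∀ u, ∀ y ∈ L.toSystem u, ScaledGraph.IQC Pi u y) ↔
      ScaledGraph.SG L.toSystem ⊆ ScaledGraph.region Pi) ∧
    (ScaledGraph.IsControllable L.A L.B →
      List.TFAE [
        ∃ P : Matrix (Fin m) (Fin m) ℝ, P.IsSymm ∧ ScaledGraph.NegSemidef (L.kypMatrix Pi P),
        ∀ u, ∀ y ∈ L.toSystem u, ScaledGraph.IQC Pi u y,
        ScaledGraph.SG L.toSystem ⊆ ScaledGraph.region Pi]) := by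
  have h12 : (∃ P : Matrix (Fin m) (Fin m) ℝ, P.IsSymm ∧
      ScaledGraph.NegSemidef (L.kypMatrix Pi P)) →
      ∀ u, ∀ y ∈ L.toSystem u, ScaledGraph.IQC Pi u y := fun ⟨P, hP, h⟩ u y hy =>
    L.iqc_of_negSemidef_kypMatrix hA hPi hP h hy
  have h23 := L.iqc_iff_sg_subset_region Pi
  refine ⟨h12, fun h => h23.1 (h12 h), h23, fun hAB => ?_⟩
  tfae_have 1 → 2 := h12
  tfae_have 2 ↔ 3 := h23
  tfae_have 2 → 1 := L.exists_negSemidef_kypMatrix hA hAB hPi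
  tfae_finish
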